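/- A hypergraph on a vertex set $V$ is identified with its set of edges $\mathcal F\subseteq 2^V$. It is $r$-uniform if $|A|=r$ for all $A\in\mathcal F$, linear if $|A\cap B|\le 1$ for all distinct $A,B\in\mathcal F$, and regular if every vertex lies in the same number of edges. It contains an $r\times r$ grid if there are disjoint subfamilies $\mathcal A,\mathcal B\subseteq\mathcal F$ with $|\mathcal A|=|\mathcal B|=r$ such that distinct members of $\mathcal A$ are disjoint, distinct members of $\mathcal B$ are disjoint, and $|A\cap B|=1$ for all $A\in\mathcal A$, $B\in\mathcal B$. It contains a triangle if there are $C_1,C_2,C_3\in\mathcal F$ with $|C_1\cap C_2|=|C_2\cap C_3|=|C_3\cap C_1|=1$ and $C_1\cap C_2\ne C_1\cap C_3$. A perfect matching of $\mathcal F$ is a subfamily of $\mathcal F$ that covers every vertex exactly once, and $\mathcal F$ decomposes into perfect matchings if it is a disjoint union of perfect matchings of $\mathcal F$. Let $\mathrm{ex}_r(n,\{\mathbb I_{\ge 2},\mathbb T_3,\mathbb G_{r\times r}\})$ denote the maximum number of edges of an $r$-uniform hypergraph on $n$ vertices that contains no two distinct edges with at least two common vertices, no triangle and no $r\times r$ grid.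 Theorem. (1) For every $r\ge 4$ there exist $n_0(r)$ and $\beta_r>0$ such that for all $n\ge n_0(r)$ $$\mathrm{ex}_r(n,\{\mathbb I_{\ge 2},\mathbb T_3,\mathbb G_{r\times r}\})>n^2e^{-\beta_r\sqrt{\log n}},$$ and there is a linear $r$-uniform hypergraph $\mathcal F$ on $n$ vertices that contains neither an $r\times r$ grid nor a triangle, with $|\mathcal F|\ge n^2e^{-\beta_r\sqrt{\log n}}$, and such that, if $r$ divides $n$, $\mathcal F$ decomposes into perfect matchings and, in particular, is regular. (2) For $r=3$ the same holds with the weaker bound: there exist $n_0(3)$ and $\beta_3>0$ such that for all $n\ge n_0(3)$ $$\mathrm{ex}_3(n,\{\mathbb I_{\ge 2},\mathbb T_3,\mathbb G_{3\times 3}\})>n^{1.6}e^{-\beta_3\sqrt{\log n}},$$ and there is a linear $3$-uniform hypergraph $\mathcal F$ on $n$ vertices that contains neither a $3\times 3$ grid nor a triangle, with $|\mathcal F|\ge n^{1.6}e^{-\beta_3\sqrt{\log n}}$, and such that, if $3$ divides $n$, $\mathcal F$ decomposes into perfect matchings and, in particular, is regular. -/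

import Mathlib

/-! A hypergraph on the vertex type `V` is identified with its edge set
`F : Finset (Finset V)`; it is `r`-uniform when `(F : Set (Finset V)).Sized r`. -/

namespace HypergraphTuran

variable {V : Type*} [DecidableEq V]

/-- Any two distinct edges share at most one vertex. -/
def IsLinear (F : Finset (Finset V)) : Prop :=
  ∀ A ∈ F, ∀ B ∈ F, A ≠ B → (A ∩ B).card ≤ 1

/-- The number of edges containing `x`. -/
def degree (F : Finset (Finset V)) (x : V) : ℕ :=
  (F.filter fun A => x ∈ A).card

/-- All vertices have the same degree. -/
def IsRegular (F : Finset (Finset V)) : Prop :=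
  ∃ k : ℕ, ∀ x : V, degree F x = k

/-- `M` is a subfamily of `F` covering every vertex exactly once. -/
def IsPerfectMatching (F M : Finset (Finset V)) : Prop :=
  M ⊆ F ∧ ∀ x : V, ∃! A, A ∈ M ∧ x ∈ A

/-- `F` is the disjoint union of some of its perfect matchings. -/
def DecomposesIntoPerfectMatchings (F : Finset (Finset V)) : Prop :=
  ∃ D : Finset (Finset (Finset V)),
    (∀ M ∈ D, IsPerfectMatching F M) ∧
    (∀ M ∈ D, ∀ N ∈ D, M ≠ N → Disjoint M N) ∧
    D.biUnion id = F

/-- The families that consist of two distinct edges with at least two common vertices. -/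
def bigIntersections (V : Type*) [DecidableEq V] : Set (Finset (Finset V)) :=
  {C | ∃ A B : Finset V, A ≠ B ∧ 2 ≤ (A ∩ B).card ∧ C = {A, B}}

/-- The triangles: three sets that pairwise intersect in three distinct singletons. -/
def triangles (V : Type*) [DecidableEq V] : Set (Finset (Finset V)) :=
  {C | ∃ C₁ C₂ C₃ : Finset V,
    (C₁ ∩ C₂).card = 1 ∧ (C₂ ∩ C₃).card = 1 ∧ (C₃ ∩ C₁).card = 1 ∧
    C₁ ∩ C₂ ≠ C₁ ∩ C₃ ∧ C = {C₁, C₂, C₃}}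

/-- The `a × b` grids: `a` pairwise disjoint sets and `b` further pairwise disjoint sets,
such that each of the former meets each of the latter in exactly one vertex. -/
def grids (V : Type*) [DecidableEq V] (a b : ℕ) : Set (Finset (Finset V)) :=
  {C | ∃ P Q : Finset (Finset V),
    Disjoint P Q ∧ P.card = a ∧ Q.card = b ∧
    (∀ A ∈ P, ∀ A' ∈ P, A ≠ A' → Disjoint A A') ∧
    (∀ B ∈ Q, ∀ B' ∈ Q, B ≠ B' → Disjoint B B') ∧
    (∀ A ∈ P, ∀ B ∈ Q, (A ∩ B).card = 1) ∧
    C = P ∪ Q}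

/-- No subfamily of `F` belongs to the class `H` of forbidden configurations. -/
def Avoids (F : Finset (Finset V)) (H : Set (Finset (Finset V))) : Prop :=
  ∀ C ⊆ F, C ∉ H

open Classical in
/-- The Turán number: the largest number of edges of an `r`-uniform hypergraph on `n`
vertices that avoids the class `H` of forbidden configurations. -/
noncomputable def turanNumber (r n : ℕ) (H : Set (Finset (Finset (Fin n)))) : ℕ :=
  (Finset.univ.filter fun F : Finset (Finset (Fin n)) =>
    (F : Set (Finset (Fin n))).Sized r ∧ Avoids F H).sup Finset.card

end HypergraphTuran

/-! The vertices form `r` classes, each a copy of `ZMod m` with `m = n / r`. An edge with position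
`x` and direction `d` picks the point `x + c i * d` from class `i`, like a line of slope `d` above
fixed abscissae `c i`. Directions come from a set `D` in `[0, M)` with `8 r M ≤ m`, so the relevant
relations modulo `m` hold in `ℤ`. There are `m * |D|` edges; linearity is immediate, and the edges
of one direction cover each of the `r m` points used exactly once.

A triangle gives a relation between three directions with nonzero coefficients of sum zero, that is,
a weighted mean. Behrend's sphere construction provides dense `D` without such means
(`exists_convexFree`).

A grid becomes a `LineNet`: `r + r` real lines in which every line meets each opposite line above
exactly one `c i`, and meets exactly one above each `c i`. In the upper envelope the two sides
alternate, and the number of opposite lines above an envelope line at `c i` is the number of indices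
between. Equal levels force meetings, so many incidences are known in advance. For `r ≥ 5` those on
top already contradict the abscissae `0, 1, 2, 3, 5`; for `r = 4` top and bottom envelopes together
are contradictory. Hence no condition on `D` beyond Behrend's is needed.

For `r = 3` nets may exist, but their slopes are two triples reflected in their common mean
(`exists_reflection`). Such a pair is determined by one triple, so a Behrend set `S` has at most
`|S|^3` of them. A random colour class with deletions destroys them all and keeps about `|S|^(3/5)`
directions, whence the exponent `1.6`. -/

namespace HypergraphTuran

/-! ### Nets of lines, levels and envelopes -/

/-- Two families of `r` lines each, the two sides being indexed by `Bool`. Lines of different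
sides have different slopes and meet above one of the points `c 0, …, c (r - 1)`; the index
`meet s a b` of that point forms a Latin square. -/
structure LineNet (r : ℕ) (c : ℕ → ℤ) where
  icpt : Bool → Fin r → ℤ
  slope : Bool → Fin r → ℤ
  meet : Bool → Fin r → Fin r → Fin r
  meet_comm : ∀ s a b, meet (!s) b a = meet s a b
  meet_inj : ∀ s a, Function.Injective (meet s a)
  eval_meet : ∀ s a b, icpt s a + c (meet s a b) * slope s a =
    icpt (!s) b + c (meet s a b) * slope (!s) b
  slope_ne : ∀ s a b, slope s a ≠ slope (!s) b

namespace LineNet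

variable {r : ℕ} {c : ℕ → ℤ} (N : LineNet r c)

/-- The height of a line above the point `c i`. -/
def val (s : Bool) (a : Fin r) (i : ℕ) : ℤ := N.icpt s a + c i * N.slope s a

/-- The net reflected in the horizontal axis. -/
def neg : LineNet r c where
  icpt s a := -N.icpt s a
  slope s a := -N.slope s a
  meet := N.meet
  meet_comm := N.meet_comm
  meet_inj := N.meet_inj
  eval_meet s a b := by linarith [N.eval_meet s a b]
  slope_ne s a b h := N.slope_ne s a b (neg_injective h)

lemma neg_val (s : Bool) (a : Fin r) (i : ℕ) : N.neg.val s a i = -N.val s a i := by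
  simp only [val, neg]; ring

lemma val_sub_val (s : Bool) (a b : Fin r) (i : ℕ) :
    N.val (!s) b i - N.val s a i =
      (c i - c (N.meet s a b)) * (N.slope (!s) b - N.slope s a) := by
  have := N.eval_meet s a b
  simp only [val]; linear_combination -this

lemma val_eq_iff (hc : StrictMono c) (s : Bool) (a b : Fin r) (i : ℕ) :
    N.val s a i = N.val (!s) b i ↔ (N.meet s a b : ℕ) = i := by
  have h := N.val_sub_val s a b i
  have h1 := N.slope_ne s a b
  constructor
  · intro h2
    rw [h2, sub_self, eq_comm, mul_eq_zero] at h
    rcases h with h | h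
    · exact (hc.injective (by linarith)).symm
    · exact absurd (by linarith) h1
  · rintro rfl
    simp at h; linarith

lemma val_lt_iff (hc : StrictMono c) (s : Bool) (a b : Fin r) (i : ℕ) :
    N.val s a i < N.val (!s) b i ↔
      ((N.meet s a b : ℕ) < i ∧ N.slope s a < N.slope (!s) b) ∨
      (i < (N.meet s a b : ℕ) ∧ N.slope (!s) b < N.slope s a) := by
  rw [← sub_pos, val_sub_val, mul_pos_iff, sub_pos, sub_pos, sub_neg, sub_neg,
    hc.lt_iff_lt, hc.lt_iff_lt]

lemma exists_meet_eq (s : Bool) (a i : Fin r) : ∃ b, N.meet s a b = i :=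
  Finite.injective_iff_surjective.1 (N.meet_inj s a) i

/-- The number of lines of side `s` that pass strictly above height `y` at `c i`. -/
def above (s : Bool) (i : ℕ) (y : ℤ) : ℕ := (Finset.univ.filter fun a => y < N.val s a i).card

/-- At `c i` every line meets exactly one opposite line, which gives a height-preserving injection
between the sides. So both sides occupy the same heights there, and levels may be counted on either
side. -/
lemma above_le (hc : StrictMono c) (s : Bool) (i : Fin r) (y : ℤ) :
    N.above s i y ≤ N.above (!s) i y := by
  choose f hf using fun a => N.exists_meet_eq s a i
  have hv : ∀ a, N.val s a i = N.val (!s) (f a) i := fun a =>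
    (N.val_eq_iff hc s a (f a) i).2 (by rw [hf])
  refine Finset.card_le_card_of_injOn f ?_ ?_
  · intro a ha
    simp only [Finset.coe_filter, Finset.mem_univ, true_and, Set.mem_ofPred_eq] at ha ⊢
    rwa [← hv]
  · intro a _ a' _ h
    apply N.meet_inj (!s) (f a)
    rw [N.meet_comm, hf, N.meet_comm, h, hf]

lemma above_not (hc : StrictMono c) (s : Bool) (i : Fin r) (y : ℤ) :
    N.above (!s) i y = N.above s i y := by
  refine le_antisymm ?_ (N.above_le hc s i y)
  simpa using N.above_le hc (!s) i y

lemma above_lt (s : Bool) (b : Fin r) (i : ℕ) {y : ℤ} (h : y < N.val s b i) :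
    N.above s i (N.val s b i) < N.above s i y := by
  apply Finset.card_lt_card
  refine Finset.ssubset_iff_of_subset ?_ |>.2 ⟨b, by simpa using h, by simp⟩
  intro a ha
  simp only [Finset.mem_filter, Finset.mem_univ, true_and] at ha ⊢
  exact h.trans ha

/-- Lines of different sides with equally many opposite lines above them meet. -/
lemma val_eq_of_above_eq (hc : StrictMono c) (s : Bool) (a b : Fin r) (i : Fin r)
    (h : N.above (!s) i (N.val s a i) = N.above s i (N.val (!s) b i)) :
    N.val s a i = N.val (!s) b i := by
  rcases lt_trichotomy (N.val s a i) (N.val (!s) b i) with h1 | h1 | h1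
  · have := N.above_lt (!s) b i h1
    rw [N.above_not hc, N.above_not hc] at this
    rw [N.above_not hc] at h
    omega
  · exact h1
  · have := N.above_lt s a i h1
    rw [N.above_not hc] at h
    omega

/-- The line `a` of side `s` runs above all lines of the other side between `c (j - 1)` and
`c j`. -/
def Top (j : ℕ) (s : Bool) (a : Fin r) : Prop :=
  ∀ b, (j ≤ (N.meet s a b : ℕ) → N.slope s a < N.slope (!s) b) ∧
    ((N.meet s a b : ℕ) < j → N.slope (!s) b < N.slope s a)

/-- The opposite lines above `a` at `c i` are those that cross it strictly between the gap and `c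
i`. Each index carries exactly one crossing with `a`, so it suffices to count indices. -/
lemma Top.above_eq (hc : StrictMono c) {N : LineNet r c} {j : ℕ} {s : Bool} {a : Fin r}
    (h : N.Top j s a)
    (hj : j ≤ r) (i : Fin r) :
    N.above (!s) i (N.val s a i) = if (i : ℕ) < j then j - 1 - i else i - j := by
  have key : N.above (!s) i (N.val s a i) =
      (if (i : ℕ) < j then Finset.Ioo (i : ℕ) j else Finset.Ico j i).card := by
    refine Finset.card_bij (fun b _ => (N.meet s a b : ℕ)) ?_ ?_ ?_
    · intro b hb
      rw [Finset.mem_filter, N.val_lt_iff hc] at hb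
      have h1 := h b
      rcases hb.2 with h2 | h2
      · have h3 : j ≤ (N.meet s a b : ℕ) := by
          by_contra h4
          exact absurd (h1.2 (by omega)) (by linarith [h2.2])
        rw [if_neg (by omega), Finset.mem_Ico]; omega
      · have h3 : (N.meet s a b : ℕ) < j := by
          by_contra h4
          exact absurd (h1.1 (by omega)) (by linarith [h2.2])
        rw [if_pos (by omega), Finset.mem_Ioo]; omega
    · intro b _ b' _ hbb
      exact N.meet_inj s a (Fin.ext hbb)
    · intro k hk
      have hkr : k < r := by
        split_ifs at hk
        · rw [Finset.mem_Ioo] at hk; omega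
        · rw [Finset.mem_Ico] at hk; have := i.2; omega
      obtain ⟨b, hb⟩ := N.exists_meet_eq s a ⟨k, hkr⟩
      have hb' : (N.meet s a b : ℕ) = k := by rw [hb]
      refine ⟨b, ?_, hb'⟩
      rw [Finset.mem_filter, N.val_lt_iff hc]
      refine ⟨Finset.mem_univ _, ?_⟩
      split_ifs at hk with hij
      · rw [Finset.mem_Ioo] at hk
        exact Or.inr ⟨by omega, (h b).2 (by omega)⟩
      · rw [Finset.mem_Ico] at hk
        exact Or.inl ⟨by omega, (h b).1 (by omega)⟩
  rw [key]
  split_ifs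
  · rw [Nat.card_Ioo]; omega
  · rw [Nat.card_Ico]

/-- Two lines that run above all lines of the opposite side in the same gap are on one side. -/
lemma Top.side_eq {N : LineNet r c} {j : ℕ} {s t : Bool} {a b : Fin r}
    (h : N.Top j s a)
    (h' : N.Top j t b) : s = t := by
  by_contra hne
  obtain rfl : t = !s := by cases s <;> cases t <;> simp_all
  have h1 := h b
  have h2 := h' a
  rw [N.meet_comm, Bool.not_not] at h2
  rcases le_or_gt j (N.meet s a b : ℕ) with h3 | h3
  · exact lt_asymm (h1.1 h3) (h2.1 h3)
  · exact lt_asymm (h1.2 h3) (h2.2 h3)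

/-- At the highest point above `c i` the net has a line that is on top before and a line of the
other side that is on top afterwards. -/
lemma exists_top_pair (hc : StrictMono c) (i : Fin r) :
    ∃ s a b, N.Top i s a ∧ N.Top (i + 1) (!s) b := by
  obtain ⟨a, -, ha⟩ := Finset.exists_max_image Finset.univ (fun a => N.val true a i) ⟨i, by simp⟩
  obtain ⟨b, hb⟩ := N.exists_meet_eq true a i
  have hab : N.val true a i = N.val false b i :=
    (N.val_eq_iff hc true a b i).2 (by rw [hb])
  have hmax : ∀ s x, N.val s x i ≤ N.val true a i := by
    intro s x
    cases s
    · obtain ⟨y, hy⟩ := N.exists_meet_eq false x i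
      have : N.val false x i = N.val true y i := (N.val_eq_iff hc false x y i).2 (by rw [hy])
      rw [this]; exact ha y (by simp)
    · exact ha x (by simp)
  have main : ∀ s x y, N.val s x i = N.val true a i → N.val (!s) y i = N.val true a i →
      N.slope s x < N.slope (!s) y → N.Top i s x ∧ N.Top (i + 1) (!s) y := by
    intro s x y hx hy hxy
    have hmeet : (N.meet s x y : ℕ) = i := (N.val_eq_iff hc s x y i).1 (by rw [hx, hy])
    constructor
    · intro z
      by_cases hz : (N.meet s x z : ℕ) = i
      · have : z = y := N.meet_inj s x (Fin.ext (hz.trans hmeet.symm))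
        subst this
        exact ⟨fun _ => hxy, fun h => by omega⟩
      · have h1 : ¬ N.val s x i < N.val (!s) z i := by rw [hx]; exact not_lt.2 (hmax _ _)
        rw [N.val_lt_iff hc] at h1
        have h2 := N.slope_ne s x z
        push Not at h1
        exact ⟨fun h => lt_of_le_of_ne (h1.2 (by omega)) h2,
          fun h => lt_of_le_of_ne (h1.1 (by omega)) h2.symm⟩
    · intro z
      have hm : (N.meet (!s) y x : ℕ) = i := by rw [N.meet_comm]; exact hmeet
      by_cases hz : (N.meet (!s) y z : ℕ) = i
      · have : z = x := N.meet_inj (!s) y (Fin.ext (hz.trans hm.symm))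
        subst this
        rw [Bool.not_not]
        exact ⟨fun h => by omega, fun _ => hxy⟩
      · have h1 : ¬ N.val (!s) y i < N.val (!!s) z i := by rw [hy]; exact not_lt.2 (hmax _ _)
        rw [N.val_lt_iff hc] at h1
        have h2 := N.slope_ne (!s) y z
        push Not at h1
        exact ⟨fun h => lt_of_le_of_ne (h1.2 (by omega)) h2,
          fun h => lt_of_le_of_ne (h1.1 (by omega)) h2.symm⟩
  -- Of the two lines through the highest point, the one of smaller slope is on top on the left.
  rcases lt_or_gt_of_ne (N.slope_ne true a b) with h | h
  · exact ⟨true, a, b, main true a b rfl hab.symm h⟩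
  · exact ⟨false, b, a, main false b a hab.symm rfl h⟩

/-- The sides of the lines on top of consecutive gaps alternate. -/
lemma exists_top (hc : StrictMono c) (hr : 0 < r) :
    ∃ (s : Bool) (a : ℕ → Fin r), ∀ j ≤ r, N.Top j (xor s j.bodd) (a j) := by
  suffices h : ∃ s : Bool, ∀ j ≤ r, ∃ a, N.Top j (xor s j.bodd) a by
    obtain ⟨s, hs⟩ := h
    have : Nonempty (Fin r) := ⟨⟨0, hr⟩⟩
    choose! a ha using hs
    exact ⟨s, a, ha⟩
  obtain ⟨s, a, b, h0, -⟩ := N.exists_top_pair hc ⟨0, hr⟩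
  refine ⟨s, fun j => ?_⟩
  induction j with
  | zero => exact fun _ => ⟨a, by simpa using h0⟩
  | succ j ih =>
    intro hj
    obtain ⟨x, hx⟩ := ih (by omega)
    obtain ⟨t, y, z, hy, hz⟩ := N.exists_top_pair hc ⟨j, hj⟩
    -- The two lines on top of gap `j` need not be identified; it is enough that their sides agree.
    obtain rfl := hx.side_eq hy
    exact ⟨z, by simpa using hz⟩

/-- Lines on top of gaps `j` and `k` of different parity meet half way in between. -/
lemma Top.val_eq (hc : StrictMono c) {N : LineNet r c} {j k : ℕ} {s : Bool} {a b : Fin r}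
    (h : N.Top j s a)
    (h' : N.Top k (!s) b) (hj : j ≤ r) (hk : k ≤ r) (i : Fin r) (hi : j + k = 2 * i + 1) :
    N.val s a i = N.val (!s) b i := by
  apply N.val_eq_of_above_eq hc
  have h1 := h.above_eq hc hj i
  have h2 := h'.above_eq hc hk i
  rw [Bool.not_not] at h2
  -- As `j + k = 2 * i + 1`, one gap lies left of `c i` and the other right of it, at the same
  -- distance in indices.
  rw [h1, h2]
  split_ifs <;> omega

/-- Exactly one opposite line passes through the point, and the other `r - 1` run above or below.
This turns levels counted from below into levels counted from above. -/
lemma above_add_above_neg (hc : StrictMono c) (s : Bool) (a : Fin r) (i : Fin r) :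
    N.above (!s) i (N.val s a i) + N.neg.above (!s) i (N.neg.val s a i) + 1 = r := by
  obtain ⟨b, hb⟩ := N.exists_meet_eq s a i
  have h1 : N.neg.above (!s) i (N.neg.val s a i) =
      (Finset.univ.filter fun x => N.val (!s) x i < N.val s a i).card := by
    simp only [above, neg_val, neg_lt_neg_iff]
  have h2 : (Finset.univ.filter fun x => N.val (!s) x i = N.val s a i).card = 1 := by
    rw [Finset.card_eq_one]
    refine ⟨b, Finset.ext fun x => ?_⟩
    rw [Finset.mem_filter, Finset.mem_singleton, eq_comm, N.val_eq_iff hc]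
    constructor
    · exact fun h => N.meet_inj s a (Fin.ext (h.2.trans (by rw [hb])))
    · rintro rfl; exact ⟨Finset.mem_univ _, by rw [hb]⟩
  have h3 := Finset.card_filter_add_card_filter_not (s := (Finset.univ : Finset (Fin r)))
    (fun x => N.val s a i < N.val (!s) x i)
  have h4 := Finset.card_filter_add_card_filter_not
    (s := (Finset.univ : Finset (Fin r)).filter fun x => ¬ N.val s a i < N.val (!s) x i)
    (fun x => N.val (!s) x i = N.val s a i)
  rw [Finset.filter_filter, Finset.filter_filter] at h4
  have e1 : (Finset.univ.filter fun x => ¬ N.val s a i < N.val (!s) x i ∧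
      N.val (!s) x i = N.val s a i) = Finset.univ.filter fun x => N.val (!s) x i = N.val s a i :=
    Finset.filter_congr fun x _ => by constructor <;> intro h <;> [exact h.2; exact ⟨by omega, h⟩]
  have e2 : (Finset.univ.filter fun x => ¬ N.val s a i < N.val (!s) x i ∧
      ¬ N.val (!s) x i = N.val s a i) = Finset.univ.filter fun x => N.val (!s) x i < N.val s a i :=
    Finset.filter_congr fun x _ => by omega
  rw [e1, e2, h2] at h4
  rw [h1, above]
  rw [Finset.card_univ, Fintype.card_fin] at h3
  omega

/-- A line on top of gap `j` and a line of the other side at the bottom of gap `k` meet at `c i`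
when their levels there agree. -/
lemma Top.val_eq_neg (hc : StrictMono c) {N : LineNet r c} {j k : ℕ} {s : Bool} {a b : Fin r}
    (h : N.Top j s a)
    (h' : N.neg.Top k (!s) b) (hj : j ≤ r) (hk : k ≤ r) (i : Fin r)
    (hi : (if (i : ℕ) < j then j - 1 - i else i - j) +
      (if (i : ℕ) < k then k - 1 - i else i - k) + 1 = r) :
    N.val s a i = N.val (!s) b i := by
  apply N.val_eq_of_above_eq hc
  have h1 := h.above_eq hc hj i
  have h2 := h'.above_eq hc hk i
  have h3 := N.above_add_above_neg hc (!s) b i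
  rw [Bool.not_not] at h2 h3
  omega

/-- The line on top at the far right is the one at the bottom at the far left, at least up to
side. -/
lemma Top.side_eq_neg (hc : StrictMono c) {N : LineNet r c} {s t : Bool} {a b : Fin r} (hr : 2 ≤ r)
    (h : N.Top r s a) (h' : N.neg.Top 0 t b) : t = s := by
  by_contra hne
  obtain rfl : t = !s := by cases s <;> cases t <;> simp_all
  -- On opposite sides the levels `r - 1 - i` from the top and `i` from the bottom would agree at
  -- every `i`, but two lines of different slopes meet only once.
  have key : ∀ i : Fin r, (N.meet s a b : ℕ) = i := fun i =>
    (N.val_eq_iff hc s a b i).1 (h.val_eq_neg hc h' le_rfl (Nat.zero_le _) i (by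
      have := i.2; simp; omega))
  have h0 := key ⟨0, by omega⟩
  have h1 := key ⟨1, by omega⟩
  simp at h0 h1
  omega

end LineNet

/-! ### Nets above the chosen abscissae -/

/-- The abscissae used for the vertex classes: `0, 1, 2, 3, 5, 6, 7, …`. -/
def abscissa (i : ℕ) : ℤ := if i < 4 then i else i + 1

lemma abscissa_strictMono : StrictMono abscissa := by
  refine strictMono_nat_of_lt_succ fun i => ?_
  simp only [abscissa]
  split_ifs <;> push_cast <;> omega

lemma abscissa_nonneg (i : ℕ) : 0 ≤ abscissa i := by
  simp only [abscissa]; split_ifs <;> omega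

lemma abscissa_le {i r : ℕ} (h : i < r) : abscissa i ≤ r := by
  simp only [abscissa]; split_ifs <;> omega

namespace LineNet

variable {r : ℕ}

/-- The lines on top of gaps `0, …, 5` meet in nine prescribed points. With abscissae `0, 1, 2, 3,
4` the tangents of a parabola would satisfy these relations; moving the last abscissa to `5` leaves
only solutions in which opposite slopes coincide. -/
lemma false_of_five_le (N : LineNet r abscissa) (hr : 5 ≤ r) : False := by
  have hc := abscissa_strictMono
  obtain ⟨s, a, ha⟩ := N.exists_top hc (by omega)
  have t0 : N.Top 0 s (a 0) := by simpa using ha 0 (by omega)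
  have t1 : N.Top 1 (!s) (a 1) := by simpa using ha 1 (by omega)
  have t2 : N.Top 2 s (a 2) := by simpa using ha 2 (by omega)
  have t3 : N.Top 3 (!s) (a 3) := by simpa using ha 3 (by omega)
  have t4 : N.Top 4 s (a 4) := by simpa using ha 4 (by omega)
  have t5 : N.Top 5 (!s) (a 5) := by simpa using ha 5 (by omega)
  have e01 := t0.val_eq hc t1 (by omega) (by omega) ⟨0, by omega⟩ (by simp)
  have e03 := t0.val_eq hc t3 (by omega) (by omega) ⟨1, by omega⟩ (by simp)
  have e05 := t0.val_eq hc t5 (by omega) (by omega) ⟨2, by omega⟩ (by simp)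
  have e21 := t2.val_eq hc t1 (by omega) (by omega) ⟨1, by omega⟩ (by simp)
  have e23 := t2.val_eq hc t3 (by omega) (by omega) ⟨2, by omega⟩ (by simp)
  have e25 := t2.val_eq hc t5 (by omega) (by omega) ⟨3, by omega⟩ (by simp)
  have e41 := t4.val_eq hc t1 (by omega) (by omega) ⟨2, by omega⟩ (by simp)
  have e43 := t4.val_eq hc t3 (by omega) (by omega) ⟨3, by omega⟩ (by simp)
  have e45 := t4.val_eq hc t5 (by omega) (by omega) ⟨4, by omega⟩ (by simp)
  refine N.slope_ne s (a 0) (a 1) ?_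
  simp only [val, abscissa] at *
  norm_num at *
  linarith

/-- The abscissae are now equally spaced, so the top envelope alone does not suffice. Adding three
bottom lines yields four lines on each side and all sixteen meetings, a linear system that forces
equal opposite slopes. -/
lemma false_of_four (N : LineNet 4 abscissa) : False := by
  have hc := abscissa_strictMono
  obtain ⟨s, a, ha⟩ := N.exists_top hc (by omega)
  obtain ⟨t, b, hb⟩ := N.neg.exists_top hc (by omega)
  have t0 : N.Top 0 s (a 0) := by simpa using ha 0 (by omega)
  have t1 : N.Top 1 (!s) (a 1) := by simpa using ha 1 (by omega)
  have t2 : N.Top 2 s (a 2) := by simpa using ha 2 (by omega)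
  have t3 : N.Top 3 (!s) (a 3) := by simpa using ha 3 (by omega)
  have t4 : N.Top 4 s (a 4) := by simpa using ha 4 (by omega)
  have b0 : N.neg.Top 0 t (b 0) := by simpa using hb 0 (by omega)
  -- This synchronises the alternation of sides in the two envelopes.
  obtain rfl := t4.side_eq_neg hc (by omega) b0
  have b1 : N.neg.Top 1 (!t) (b 1) := by simpa using hb 1 (by omega)
  have b2 : N.neg.Top 2 t (b 2) := by simpa using hb 2 (by omega)
  have b2' : N.neg.Top 2 (!!t) (b 2) := by simpa using hb 2 (by omega)
  have b3 : N.neg.Top 3 (!t) (b 3) := by simpa using hb 3 (by omega)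
  have e01 := t0.val_eq hc t1 (by omega) (by omega) ⟨0, by omega⟩ (by simp)
  have e03 := t0.val_eq hc t3 (by omega) (by omega) ⟨1, by omega⟩ (by simp)
  have e21 := t2.val_eq hc t1 (by omega) (by omega) ⟨1, by omega⟩ (by simp)
  have e23 := t2.val_eq hc t3 (by omega) (by omega) ⟨2, by omega⟩ (by simp)
  have e41 := t4.val_eq hc t1 (by omega) (by omega) ⟨2, by omega⟩ (by simp)
  have e43 := t4.val_eq hc t3 (by omega) (by omega) ⟨3, by omega⟩ (by simp)
  have e05 := t0.val_eq_neg hc b1 (by omega) (by omega) ⟨2, by omega⟩ (by simp)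
  have e07 := t0.val_eq_neg hc b3 (by omega) (by omega) ⟨3, by omega⟩ (by simp)
  have e25 := t2.val_eq_neg hc b1 (by omega) (by omega) ⟨3, by omega⟩ (by simp)
  have e27 := t2.val_eq_neg hc b3 (by omega) (by omega) ⟨0, by omega⟩ (by simp)
  have e45 := t4.val_eq_neg hc b1 (by omega) (by omega) ⟨0, by omega⟩ (by simp)
  have e47 := t4.val_eq_neg hc b3 (by omega) (by omega) ⟨1, by omega⟩ (by simp)
  have e16 := t1.val_eq_neg hc b2' (by omega) (by omega) ⟨3, by omega⟩ (by simp)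
  have e36 := t3.val_eq_neg hc b2' (by omega) (by omega) ⟨0, by omega⟩ (by simp)
  have e65 := b2.val_eq hc b1 (by omega) (by omega) ⟨1, by omega⟩ (by simp)
  have e67 := b2.val_eq hc b3 (by omega) (by omega) ⟨2, by omega⟩ (by simp)
  refine N.slope_ne t (a 0) (a 1) ?_
  rw [neg_val, neg_val] at e65 e67
  simp only [val, abscissa, Bool.not_not] at *
  norm_num at *
  linarith

lemma false_of_four_le (N : LineNet r abscissa) (hr : 4 ≤ r) : False := by
  rcases eq_or_lt_of_le hr with rfl | h
  · exact N.false_of_four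
  · exact N.false_of_five_le h

/-- In a net of three plus three lines, the slopes of one side arise from those of the other by
reflection in their common mean. -/
lemma exists_reflection (N : LineNet 3 abscissa) : ∃ s, ∃ a b : Fin 3 → Fin 3,
    (∀ i, N.slope s (a i) + N.slope (!s) (b i) = N.slope s (a 0) + N.slope (!s) (b 0)) ∧
    ∑ i, N.slope s (a i) = ∑ i, N.slope (!s) (b i) := by
  have hc := abscissa_strictMono
  obtain ⟨s, a, ha⟩ := N.exists_top hc (by omega)
  obtain ⟨t, b, hb⟩ := N.neg.exists_top hc (by omega)
  have t0 : N.Top 0 s (a 0) := by simpa using ha 0 (by omega)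
  have t1 : N.Top 1 (!s) (a 1) := by simpa using ha 1 (by omega)
  have t2 : N.Top 2 s (a 2) := by simpa using ha 2 (by omega)
  have t3 : N.Top 3 (!s) (a 3) := by simpa using ha 3 (by omega)
  have b0 : N.neg.Top 0 t (b 0) := by simpa using hb 0 (by omega)
  obtain rfl := t3.side_eq_neg hc (by omega) b0
  have b1 : N.neg.Top 1 s (b 1) := by simpa using hb 1 (by omega)
  have b1' : N.neg.Top 1 (!!s) (b 1) := by simpa using hb 1 (by omega)
  have b2 : N.neg.Top 2 (!s) (b 2) := by simpa using hb 2 (by omega)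
  have e01 := t0.val_eq hc t1 (by omega) (by omega) ⟨0, by omega⟩ (by simp)
  have e03 := t0.val_eq hc t3 (by omega) (by omega) ⟨1, by omega⟩ (by simp)
  have e05 := t0.val_eq_neg hc b2 (by omega) (by omega) ⟨2, by omega⟩ (by simp)
  have e21 := t2.val_eq hc t1 (by omega) (by omega) ⟨1, by omega⟩ (by simp)
  have e23 := t2.val_eq hc t3 (by omega) (by omega) ⟨2, by omega⟩ (by simp)
  have e25 := t2.val_eq_neg hc b2 (by omega) (by omega) ⟨0, by omega⟩ (by simp)
  have e14 := t1.val_eq_neg hc b1' (by omega) (by omega) ⟨2, by omega⟩ (by simp)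
  have e34 := t3.val_eq_neg hc b1' (by omega) (by omega) ⟨0, by omega⟩ (by simp)
  have e45 := b1.val_eq hc b2 (by omega) (by omega) ⟨1, by omega⟩ (by simp)
  rw [neg_val, neg_val] at e45
  -- The reflection pairs the top lines of gaps `0` and `3`, those of gaps `2` and `1`, and the
  -- bottom lines of gaps `1` and `2`.
  refine ⟨s, ![a 0, a 2, b 1],
    ![a 3, a 1, b 2], fun i => ?_, ?_⟩
  · simp only [val, abscissa, Bool.not_not] at *
    norm_num at *
    fin_cases i <;> simp <;> linarith
  · simp only [val, abscissa, Bool.not_not, Fin.sum_univ_three] at *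
    norm_num [Matrix.cons_val_two, Matrix.vecHead, Matrix.vecTail] at *
    linarith

end LineNet

/-! ### Regularity, small residues and weighted means -/

lemma DecomposesIntoPerfectMatchings.isRegular {V : Type*} [DecidableEq V]
    {F : Finset (Finset V)} (h : DecomposesIntoPerfectMatchings F) : IsRegular F := by
  obtain ⟨D, hD, hdis, rfl⟩ := h
  refine ⟨D.card, fun x => ?_⟩
  rw [degree, Finset.filter_biUnion, Finset.card_biUnion]
  · rw [Finset.sum_congr rfl (g := fun _ => 1), Finset.sum_const, smul_eq_mul, mul_one]
    intro M hM
    obtain ⟨A, hA, hA'⟩ := (hD M hM).2 x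
    rw [Finset.card_eq_one]
    refine ⟨A, Finset.ext fun B => ?_⟩
    rw [Finset.mem_filter, Finset.mem_singleton]
    exact ⟨fun hB => hA' B hB, fun hB => hB ▸ hA⟩
  · intro M hM N hN hne
    exact Finset.disjoint_filter_filter (hdis M hM N hN hne)

lemma eq_zero_of_intCast_eq_zero {m : ℕ} {z : ℤ} (h : (z : ZMod m) = 0) (hz : |z| < m) :
    z = 0 :=
  Int.eq_zero_of_abs_lt_dvd ((ZMod.intCast_zmod_eq_zero_iff_dvd z m).1 h) hz

/-- `D` contains no nontrivial weighted means of two of its elements, the weights being at most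
`K`. -/
def ConvexFree (K : ℕ) (D : Finset ℕ) : Prop :=
  ∀ p q : ℕ, 0 < p → 0 < q → p ≤ K → q ≤ K → ∀ a ∈ D, ∀ b ∈ D, ∀ c ∈ D,
    p * a + q * b = (p + q) * c → a = b

lemma ConvexFree.eq_of_int {K : ℕ} {D : Finset ℕ} (hD : ConvexFree K D) {p q : ℤ}
    (hpq : 0 < p * q) (hp : |p| ≤ K) (hq : |q| ≤ K) {a b c : ℕ} (ha : a ∈ D) (hb : b ∈ D)
    (hc : c ∈ D) (h : p * a + q * b = (p + q) * c) : a = b ∧ a = c := by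
  have key : ∀ p q : ℤ, 0 < p → 0 < q → |p| ≤ K → |q| ≤ K →
      p * a + q * b = (p + q) * c → a = b ∧ a = c := by
    intro p q hp0 hq0 hp hq h
    lift p to ℕ using hp0.le
    lift q to ℕ using hq0.le
    rw [Nat.abs_cast] at hp hq
    norm_cast at *
    obtain rfl := hD p q hp0 hq0 hp hq a ha b hb c hc h
    rw [← add_mul] at h
    exact ⟨rfl, Nat.eq_of_mul_eq_mul_left (by omega) h⟩
  rcases mul_pos_iff.1 hpq with ⟨h1, h2⟩ | ⟨h1, h2⟩
  · exact key p q h1 h2 hp hq h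
  · exact key (-p) (-q) (by omega) (by omega) (by rwa [abs_neg]) (by rwa [abs_neg])
      (by linarith)

/-- Two of three nonzero coefficients of sum zero share a sign, and the relation makes the element
at the third a weighted mean of the other two. -/
lemma ConvexFree.eq_of_three {K : ℕ} {D : Finset ℕ} (hD : ConvexFree K D) {p q s : ℤ}
    (hp0 : p ≠ 0) (hq0 : q ≠ 0) (hs0 : s ≠ 0) (hp : |p| ≤ K) (hq : |q| ≤ K) (hs : |s| ≤ K)
    (hsum : p + q + s = 0) {a b c : ℕ} (ha : a ∈ D) (hb : b ∈ D)
    (hc : c ∈ D) (h : p * a + q * b + s * c = 0) : a = b := by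
  obtain rfl : s = -(p + q) := by omega
  by_cases h1 : 0 < p * q
  · exact (hD.eq_of_int h1 hp hq ha hb hc (by linarith)).1
  by_cases h2 : 0 < q * (-(p + q))
  · have := hD.eq_of_int h2 hq hs hb hc ha (by linarith)
    exact this.2.symm
  by_cases h3 : 0 < p * (-(p + q))
  · have := hD.eq_of_int h3 hp hs ha hc hb (by linarith)
    exact this.2
  exfalso
  rcases lt_or_gt_of_ne hp0 with hp' | hp' <;> rcases lt_or_gt_of_ne hq0 with hq' | hq' <;>
    rcases lt_or_gt_of_ne hs0 with hs' | hs' <;>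
    first
    | exact h1 (mul_pos_of_neg_of_neg hp' hq')
    | exact h1 (mul_pos hp' hq')
    | exact h2 (mul_pos_of_neg_of_neg hq' hs')
    | exact h2 (mul_pos hq' hs')
    | exact h3 (mul_pos_of_neg_of_neg hp' hs')
    | exact h3 (mul_pos hp' hs')

/-! ### The hypergraph of lines modulo `m` -/

section Construction

variable {r m : ℕ} {V : Type*} (φ : Fin r × ZMod m ↪ V)

/-- The vertex in class `i` of the edge with position `x` and direction `d`. -/
def vertex (x : ZMod m) (d : ℕ) (i : Fin r) : V :=
  φ (i, x + ((abscissa i * d : ℤ) : ZMod m))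

variable {φ}

lemma vertex_eq_iff {x y : ZMod m} {d e : ℕ} {i j : Fin r} :
    vertex φ x d i = vertex φ y e j ↔
      i = j ∧ x + ((abscissa i * d : ℤ) : ZMod m) = y + ((abscissa i * e : ℤ) : ZMod m) := by
  rw [vertex, vertex, φ.injective.eq_iff, Prod.mk.injEq]
  constructor
  · rintro ⟨rfl, h⟩; exact ⟨rfl, h⟩
  · rintro ⟨rfl, h⟩; exact ⟨rfl, h⟩

lemma pos_eq_of_vertex_eq {x y : ZMod m} {d : ℕ} {i : Fin r}
    (h : vertex φ x d i = vertex φ y d i) : x = y :=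
  add_right_cancel (vertex_eq_iff.1 h).2

lemma abs_abscissa_mul_sub_le {M d e : ℕ} (hd : d < M) (he : e < M) (i : Fin r) :
    |abscissa i * ((d : ℤ) - e)| ≤ r * M := by
  rw [abs_mul, abs_of_nonneg (abscissa_nonneg i)]
  apply mul_le_mul (abscissa_le i.2) _ (abs_nonneg _) (by positivity)
  rw [abs_le]; omega

lemma abs_abscissa_sub_le (i j : Fin r) : |abscissa i - abscissa j| ≤ r := by
  rw [abs_le]
  have h1 := abscissa_nonneg i
  have h2 := abscissa_nonneg j
  have h3 := abscissa_le i.2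
  have h4 := abscissa_le j.2
  constructor <;> linarith

/-- Subtracting the two incidences cancels the positions and leaves `(c i - c j) * (d - e) = 0`
modulo `m`, a product too small to wrap around. -/
lemma dir_eq_of_two_vertices {M d e : ℕ} (hM : 8 * r * M ≤ m) (hd : d < M) (he : e < M)
    {x y : ZMod m} {i j : Fin r} (hij : i ≠ j) (hi : vertex φ x d i = vertex φ y e i)
    (hj : vertex φ x d j = vertex φ y e j) : d = e := by
  have h1 := (vertex_eq_iff.1 hi).2
  have h2 := (vertex_eq_iff.1 hj).2
  have h3 : (((abscissa i - abscissa j) * ((d : ℤ) - e) : ℤ) : ZMod m) = 0 := by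
    push_cast at h1 h2 ⊢
    linear_combination h1 - h2
  have hrM : 0 < r * M := Nat.mul_pos (by have := i.2; omega) (by omega)
  have h4 := eq_zero_of_intCast_eq_zero h3 (by
    have h5 := abs_abscissa_mul_sub_le hd he i
    have h6 := abs_abscissa_mul_sub_le hd he j
    rw [sub_mul]
    have h7 := abs_sub (abscissa i * ((d : ℤ) - e)) (abscissa j * ((d : ℤ) - e))
    have h8 : (8 * (r * M) : ℤ) ≤ m := by exact_mod_cast (by linarith)
    have h9 : (0 : ℤ) < r * M := by exact_mod_cast hrM
    linarith)
  rcases mul_eq_zero.1 h4 with h5 | h5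
  · exact absurd (Fin.ext (abscissa_strictMono.injective (by linarith))) hij
  · omega

lemma edge_eq_of_two_vertices {M d e : ℕ} (hM : 8 * r * M ≤ m) (hd : d < M) (he : e < M)
    {x y : ZMod m} {i j : Fin r} (hij : i ≠ j) (hi : vertex φ x d i = vertex φ y e i)
    (hj : vertex φ x d j = vertex φ y e j) : x = y ∧ d = e := by
  obtain rfl := dir_eq_of_two_vertices hM hd he hij hi hj
  exact ⟨pos_eq_of_vertex_eq hi, rfl⟩

variable [DecidableEq V] (φ)

/-- The edge with position `x` and direction `d`. -/
def edge (x : ZMod m) (d : ℕ) : Finset V := Finset.univ.image (vertex φ x d)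

/-- The edges of direction `d`. -/
def parallelClass [NeZero m] (d : ℕ) : Finset (Finset V) := Finset.univ.image fun x => edge φ x d

/-- The hypergraph of all edges with directions in `D`. -/
def lineHypergraph [NeZero m] (D : Finset ℕ) : Finset (Finset V) := D.biUnion (parallelClass φ)

variable {φ}

lemma vertex_mem_edge_iff {x y : ZMod m} {d e : ℕ} {i : Fin r} :
    vertex φ x d i ∈ edge φ y e ↔ vertex φ x d i = vertex φ y e i := by
  simp only [edge, Finset.mem_image, Finset.mem_univ, true_and]
  constructor
  · rintro ⟨j, hj⟩
    obtain ⟨rfl, -⟩ := vertex_eq_iff.1 hj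
    exact hj.symm
  · exact fun h => ⟨i, h.symm⟩

lemma vertex_mem_edge (x : ZMod m) (d : ℕ) (i : Fin r) : vertex φ x d i ∈ edge φ x d :=
  vertex_mem_edge_iff.2 rfl

lemma exists_vertex_of_mem {x : ZMod m} {d : ℕ} {v : V} (h : v ∈ edge φ x d) :
    ∃ i, v = vertex φ x d i := by
  obtain ⟨i, -, hi⟩ := Finset.mem_image.1 h
  exact ⟨i, hi.symm⟩

lemma card_edge (x : ZMod m) (d : ℕ) : (edge φ x d).card = r := by
  rw [edge, Finset.card_image_of_injective, Finset.card_univ, Fintype.card_fin]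
  exact fun i j h => (vertex_eq_iff.1 h).1

lemma mem_lineHypergraph [NeZero m] {D : Finset ℕ} {A : Finset V} :
    A ∈ lineHypergraph φ D ↔ ∃ d ∈ D, ∃ x, edge φ x d = A := by
  simp [lineHypergraph, parallelClass]

lemma edge_inj {M d e : ℕ} (hr : 2 ≤ r) (hM : 8 * r * M ≤ m) (hd : d < M) (he : e < M)
    {x y : ZMod m} (h : edge φ x d = edge φ y e) : x = y ∧ d = e := by
  have key : ∀ i, vertex φ x d i = vertex φ y e i := fun i =>
    vertex_mem_edge_iff.1 (h ▸ vertex_mem_edge x d i)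
  exact edge_eq_of_two_vertices hM hd he (i := ⟨0, by omega⟩) (j := ⟨1, by omega⟩)
    (by simp) (key _) (key _)

variable [NeZero m] {D : Finset ℕ} {M : ℕ}

lemma sized_lineHypergraph : (lineHypergraph φ D : Set (Finset V)).Sized r := by
  intro A hA
  obtain ⟨d, -, x, rfl⟩ := mem_lineHypergraph.1 (Finset.mem_coe.1 hA)
  exact card_edge x d

lemma isLinear_lineHypergraph (hM : 8 * r * M ≤ m) (hD : ∀ d ∈ D, d < M) :
    IsLinear (lineHypergraph φ D) := by
  intro A hA B hB hne
  obtain ⟨d, hd, x, rfl⟩ := mem_lineHypergraph.1 hA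
  obtain ⟨e, he, y, rfl⟩ := mem_lineHypergraph.1 hB
  rw [Finset.card_le_one]
  intro u hu v hv
  rw [Finset.mem_inter] at hu hv
  obtain ⟨i, rfl⟩ := exists_vertex_of_mem hu.1
  obtain ⟨j, rfl⟩ := exists_vertex_of_mem hv.1
  by_contra huv
  have hij : i ≠ j := fun h => huv (by rw [h])
  obtain ⟨rfl, rfl⟩ := edge_eq_of_two_vertices hM (hD d hd) (hD e he) hij
    (vertex_mem_edge_iff.1 hu.2) (vertex_mem_edge_iff.1 hv.2)
  exact hne rfl

lemma disjoint_parallelClass (hr : 2 ≤ r) (hM : 8 * r * M ≤ m) {d e : ℕ} (hd : d < M)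
    (he : e < M) (hne : d ≠ e) : Disjoint (parallelClass φ d) (parallelClass φ e) := by
  rw [Finset.disjoint_left]
  intro A hA hB
  obtain ⟨x, -, rfl⟩ := Finset.mem_image.1 hA
  obtain ⟨y, -, hy⟩ := Finset.mem_image.1 hB
  exact hne (edge_inj hr hM hd he hy.symm).2

lemma card_lineHypergraph (hr : 2 ≤ r) (hM : 8 * r * M ≤ m) (hD : ∀ d ∈ D, d < M) :
    (lineHypergraph φ D).card = m * D.card := by
  rw [lineHypergraph, Finset.card_biUnion]
  · rw [Finset.sum_congr rfl (g := fun _ => m), Finset.sum_const, smul_eq_mul, mul_comm]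
    intro d hd
    rw [parallelClass, Finset.card_image_of_injective, Finset.card_univ, ZMod.card]
    exact fun x y h => (edge_inj hr hM (hD d hd) (hD d hd) h).1
  · exact fun d hd e he hne => disjoint_parallelClass hr hM (hD d hd) (hD e he) hne

/-- Each parallel class is a perfect matching: the edge of direction `d` through the point `t` of
class `i` must have position `t - c i * d`. -/
lemma decomposes_lineHypergraph (hr : 2 ≤ r) (hM : 8 * r * M ≤ m) (hD : ∀ d ∈ D, d < M)
    (hφ : Function.Surjective φ) : DecomposesIntoPerfectMatchings (lineHypergraph φ D) := by
  refine ⟨D.image (parallelClass φ), ?_, ?_, ?_⟩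
  · intro P hP
    obtain ⟨d, hd, rfl⟩ := Finset.mem_image.1 hP
    refine ⟨Finset.subset_biUnion_of_mem _ hd, fun v => ?_⟩
    obtain ⟨⟨i, t⟩, rfl⟩ := hφ v
    have ht : φ (i, t) = vertex φ (t - ((abscissa i * d : ℤ) : ZMod m)) d i := by
      rw [vertex, sub_add_cancel]
    refine ⟨edge φ (t - ((abscissa i * d : ℤ) : ZMod m)) d,
      ⟨Finset.mem_image_of_mem _ (Finset.mem_univ _), ?_⟩, ?_⟩
    · rw [ht]; exact vertex_mem_edge _ _ _
    · rintro A ⟨hA, hv⟩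
      obtain ⟨x, -, rfl⟩ := Finset.mem_image.1 hA
      rw [ht, vertex_mem_edge_iff] at hv
      rw [pos_eq_of_vertex_eq hv]
  · intro P hP Q hQ hne
    obtain ⟨d, hd, rfl⟩ := Finset.mem_image.1 hP
    obtain ⟨e, he, rfl⟩ := Finset.mem_image.1 hQ
    exact disjoint_parallelClass hr hM (hD d hd) (hD e he) fun h => hne (by rw [h])
  · rw [Finset.image_biUnion]; rfl

/-- The three corners lie in different classes. Adding their incidence relations cancels the
positions and leaves a relation between the directions whose coefficients are differences of
abscissae, hence at most `r` in absolute value. -/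
lemma avoids_triangles (hM : 8 * r * M ≤ m) (hD : ∀ d ∈ D, d < M)
    (hconv : ConvexFree r D) : Avoids (lineHypergraph φ D) (triangles V) := by
  rintro C hC ⟨C₁, C₂, C₃, h12, h23, h31, hne, rfl⟩
  obtain ⟨d₁, hd₁, x₁, rfl⟩ := mem_lineHypergraph.1 (hC (show C₁ ∈ _ by simp))
  obtain ⟨d₂, hd₂, x₂, rfl⟩ := mem_lineHypergraph.1 (hC (show C₂ ∈ _ by simp))
  obtain ⟨d₃, hd₃, x₃, rfl⟩ := mem_lineHypergraph.1 (hC (show C₃ ∈ _ by simp))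
  obtain ⟨u, hu⟩ := Finset.card_eq_one.1 h12
  obtain ⟨v, hv⟩ := Finset.card_eq_one.1 h23
  obtain ⟨w, hw⟩ := Finset.card_eq_one.1 h31
  have hu' := Finset.mem_inter.1 (hu ▸ Finset.mem_singleton_self u)
  have hv' := Finset.mem_inter.1 (hv ▸ Finset.mem_singleton_self v)
  have hw' := Finset.mem_inter.1 (hw ▸ Finset.mem_singleton_self w)
  have huw : u ≠ w := by
    rintro rfl
    rw [hu, Finset.inter_comm, hw] at hne
    exact hne rfl
  have huv : u ≠ v := by
    rintro rfl
    have : u ∈ edge φ x₃ d₃ ∩ edge φ x₁ d₁ := Finset.mem_inter.2 ⟨hv'.2, hu'.1⟩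
    rw [hw, Finset.mem_singleton] at this
    exact huw this
  have hvw : v ≠ w := by
    rintro rfl
    have : v ∈ edge φ x₁ d₁ ∩ edge φ x₂ d₂ := Finset.mem_inter.2 ⟨hw'.2, hv'.1⟩
    rw [hu, Finset.mem_singleton] at this
    exact huv this.symm
  obtain ⟨i, rfl⟩ := exists_vertex_of_mem hu'.1
  obtain ⟨j, rfl⟩ := exists_vertex_of_mem hv'.1
  obtain ⟨k, rfl⟩ := exists_vertex_of_mem hw'.1
  have ei := vertex_mem_edge_iff.1 hu'.2
  have ej := vertex_mem_edge_iff.1 hv'.2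
  have ek := vertex_mem_edge_iff.1 hw'.2
  have hij : i ≠ j := by rintro rfl; exact huv ei
  have hjk : j ≠ k := by rintro rfl; exact hvw ej
  have hik : i ≠ k := by rintro rfl; exact huw ek.symm
  have ai : ∀ {i j : Fin r}, i ≠ j → abscissa i - abscissa j ≠ 0 := fun h h0 =>
    h (Fin.ext (abscissa_strictMono.injective (by linarith)))
  have fi := (vertex_eq_iff.1 ei).2
  have fj := (vertex_eq_iff.1 ej).2
  have fk := (vertex_eq_iff.1 ek).2
  have hrM : 0 < r * M :=
    Nat.mul_pos (by have := i.2; omega) (by have := hD _ hd₁; omega)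
  have hz : (abscissa i - abscissa k) * (d₁ : ℤ) + (abscissa j - abscissa i) * d₂ +
      (abscissa k - abscissa j) * d₃ = 0 := by
    apply eq_zero_of_intCast_eq_zero (m := m)
    · push_cast at fi fj fk ⊢
      linear_combination fi + fj + fk
    · have e : (abscissa i - abscissa k) * (d₁ : ℤ) + (abscissa j - abscissa i) * d₂ +
          (abscissa k - abscissa j) * d₃ = abscissa i * ((d₁ : ℤ) - d₂) +
          abscissa j * ((d₂ : ℤ) - d₃) + abscissa k * ((d₃ : ℤ) - d₁) := by ring
      rw [e]
      have g1 := abs_abscissa_mul_sub_le (hD _ hd₁) (hD _ hd₂) i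
      have g2 := abs_abscissa_mul_sub_le (hD _ hd₂) (hD _ hd₃) j
      have g3 := abs_abscissa_mul_sub_le (hD _ hd₃) (hD _ hd₁) k
      have h8 : (8 * (r * M) : ℤ) ≤ m := by exact_mod_cast (by linarith)
      have h9 : (0 : ℤ) < r * M := by exact_mod_cast hrM
      refine lt_of_le_of_lt (abs_add_three _ _ _) ?_
      linarith
  obtain rfl := hconv.eq_of_three (ai hik) (ai hij.symm) (ai hjk.symm) (abs_abscissa_sub_le _ _)
    (abs_abscissa_sub_le _ _) (abs_abscissa_sub_le _ _) (by ring) hd₁ hd₂ hd₃ hz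
  -- Equal directions and a common vertex make the first two edges equal, so their intersection is
  -- too large.
  obtain rfl := pos_eq_of_vertex_eq ei
  rw [Finset.inter_self] at hu
  have : vertex φ x₁ d₁ j ∈ edge φ x₁ d₁ := vertex_mem_edge _ _ _
  rw [hu, Finset.mem_singleton] at this
  exact hij (vertex_eq_iff.1 this).1.symm

/-- A grid in the hypergraph yields a net of lines in the plane. -/
lemma exists_lineNet_of_mem_grids (hr : 0 < r) (hM : 8 * r * M ≤ m) (hD : ∀ d ∈ D, d < M)
    {C : Finset (Finset V)} (hC : C ⊆ lineHypergraph φ D) (hg : C ∈ grids V r r) :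
    ∃ N : LineNet r abscissa, ∀ s a, ∃ d ∈ D, N.slope s a = d := by
  obtain ⟨P, Q, hPQ, hP, hQ, hdP, hdQ, hint, rfl⟩ := hg
  let fP := (Finset.equivFinOfCardEq hP).symm
  let fQ := (Finset.equivFinOfCardEq hQ).symm
  have hmP : ∀ a, (fP a : Finset V) ∈ lineHypergraph φ D := fun a =>
    hC (Finset.mem_union_left _ (fP a).2)
  have hmQ : ∀ a, (fQ a : Finset V) ∈ lineHypergraph φ D := fun a =>
    hC (Finset.mem_union_right _ (fQ a).2)
  simp only [mem_lineHypergraph] at hmP hmQ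
  choose d hd x hx using hmP
  choose e he y hy using hmQ
  have hL : ∀ a b, ∃ i, vertex φ (x a) (d a) i = vertex φ (y b) (e b) i := by
    intro a b
    obtain ⟨u, hu⟩ := Finset.card_eq_one.1 (hint _ (fP a).2 _ (fQ b).2)
    have hu' := Finset.mem_inter.1 (hu ▸ Finset.mem_singleton_self u)
    rw [← hx, ← hy] at hu'
    obtain ⟨i, rfl⟩ := exists_vertex_of_mem hu'.1
    exact ⟨i, vertex_mem_edge_iff.1 hu'.2⟩
  choose L hL using hL
  have hinjP : ∀ a, Function.Injective (L a) := by
    intro a b b' hbb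
    by_contra hne
    have h1 := hdQ _ (fQ b).2 _ (fQ b').2 fun h => hne (fQ.injective (Subtype.ext h))
    rw [← hy, ← hy, Finset.disjoint_left] at h1
    refine h1 (vertex_mem_edge (y b) (e b) (L a b)) ?_
    rw [← hL, hbb, hL]
    exact vertex_mem_edge _ _ _
  have hinjQ : ∀ b, Function.Injective fun a => L a b := by
    intro b a a' haa
    dsimp only at haa
    by_contra hne
    have h1 := hdP _ (fP a).2 _ (fP a').2 fun h => hne (fP.injective (Subtype.ext h))
    rw [← hx, ← hx, Finset.disjoint_left] at h1
    refine h1 (vertex_mem_edge (x a) (d a) (L a b)) ?_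
    rw [hL, haa, ← hL]
    exact vertex_mem_edge _ _ _
  have hne : ∀ a b, (d a : ℤ) ≠ e b := by
    intro a b h
    have h' : d a = e b := by exact_mod_cast h
    have h1 := hL a b
    rw [h'] at h1
    have h2 := pos_eq_of_vertex_eq h1
    refine Finset.disjoint_left.1 hPQ (fP a).2 ?_
    rw [← hx, h2, h', hy]
    exact (fQ b).2
  let o : Fin r := ⟨0, hr⟩
  -- Integer intercepts are normalised so that line `o` of the first side has intercept `0`; `Y b`
  -- is then forced by the meeting with `o`, and `X a` by the meeting with line `o` of the second
  -- side. Modulo `m` they are positions relative to `x o`.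
  let Y : Fin r → ℤ := fun b => abscissa (L o b) * ((d o : ℤ) - e b)
  let X : Fin r → ℤ := fun a => Y o + abscissa (L a o) * ((e o : ℤ) - d a)
  have hrM : 0 < r * M := Nat.mul_pos hr (by have := hD _ (hd o); omega)
  have heval : ∀ a b, X a + abscissa (L a b) * d a = Y b + abscissa (L a b) * e b := by
    intro a b
    rw [← sub_eq_zero]
    apply eq_zero_of_intCast_eq_zero (m := m)
    · have h1 := (vertex_eq_iff.1 (hL a b)).2
      have h2 := (vertex_eq_iff.1 (hL o b)).2
      have h3 := (vertex_eq_iff.1 (hL a o)).2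
      have h4 := (vertex_eq_iff.1 (hL o o)).2
      simp only [X, Y]
      push_cast at h1 h2 h3 h4 ⊢
      linear_combination h1 - h2 - h3 + h4
    -- Four terms of size at most `r * M` stay below `8 * r * M ≤ m`.
    · have e1 : X a + abscissa (L a b) * d a - (Y b + abscissa (L a b) * e b) =
          abscissa (L o o) * ((d o : ℤ) - e o) + abscissa (L a o) * ((e o : ℤ) - d a) +
          (abscissa (L a b) * ((d a : ℤ) - e b) - abscissa (L o b) * ((d o : ℤ) - e b)) := by
        simp only [X, Y]; ring
      rw [e1]
      have g1 := abs_abscissa_mul_sub_le (hD _ (hd o)) (hD _ (he o)) (L o o)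
      have g2 := abs_abscissa_mul_sub_le (hD _ (he o)) (hD _ (hd a)) (L a o)
      have g3 := abs_abscissa_mul_sub_le (hD _ (hd a)) (hD _ (he b)) (L a b)
      have g4 := abs_abscissa_mul_sub_le (hD _ (hd o)) (hD _ (he b)) (L o b)
      have h8 : (8 * (r * M) : ℤ) ≤ m := by exact_mod_cast (by linarith)
      have h9 : (0 : ℤ) < r * M := by exact_mod_cast hrM
      refine lt_of_le_of_lt (abs_add_three _ _ _) ?_
      have g5 := abs_sub (abscissa (L a b) * ((d a : ℤ) - e b))
        (abscissa (L o b) * ((d o : ℤ) - e b))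
      linarith
  refine ⟨⟨fun s => bif s then X else Y, fun s a => bif s then (d a : ℤ) else e a,
    fun s a b => bif s then L a b else L b a, ?_, ?_, ?_, ?_⟩, ?_⟩
  · rintro (_ | _) a b <;> rfl
  · rintro (_ | _) a
    · exact hinjQ a
    · exact hinjP a
  · rintro (_ | _) a b
    · exact (heval b a).symm
    · exact heval a b
  · rintro (_ | _) a b
    · exact (hne b a).symm
    · exact hne a b
  · rintro (_ | _) a
    · exact ⟨e a, he a, rfl⟩
    · exact ⟨d a, hd a, rfl⟩

lemma avoids_grids_of_four_le (hr : 4 ≤ r) (hM : 8 * r * M ≤ m) (hD : ∀ d ∈ D, d < M) :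
    Avoids (lineHypergraph φ D) (grids V r r) := by
  intro C hC hg
  obtain ⟨N, -⟩ := exists_lineNet_of_mem_grids (by omega) hM hD hC hg
  exact N.false_of_four_le hr

end Construction

/-! ### Directions for `r = 3` -/

/-- `D` contains no two triples that are disjoint and arise from one another by reflection in
their common mean. -/
def ReflectionFree (D : Finset ℕ) : Prop :=
  ∀ a b : Fin 3 → ℕ, (∀ i, a i ∈ D) → (∀ i, b i ∈ D) → (∀ i j, a i ≠ b j) →
    (∀ i, a i + b i = a 0 + b 0) → ∑ i, a i ≠ ∑ i, b i

lemma avoids_grids_of_reflectionFree {m M : ℕ} [NeZero m] {V : Type*} [DecidableEq V]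
    {φ : Fin 3 × ZMod m ↪ V} {D : Finset ℕ} (hM : 8 * 3 * M ≤ m) (hD : ∀ d ∈ D, d < M)
    (hrefl : ReflectionFree D) : Avoids (lineHypergraph φ D) (grids V 3 3) := by
  intro C hC hg
  obtain ⟨N, hN⟩ := exists_lineNet_of_mem_grids (by omega) hM hD hC hg
  obtain ⟨s, a, b, hab, hsum⟩ := N.exists_reflection
  choose f hf hfN using hN
  refine hrefl (fun i => f s (a i)) (fun i => f (!s) (b i)) (fun i => hf _ _) (fun i => hf _ _)
    ?_ ?_ ?_
  · intro i j h
    apply N.slope_ne s (a i) (b j)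
    rw [hfN, hfN]; exact_mod_cast h
  · intro i
    have := hab i
    simp only [hfN] at this
    exact_mod_cast this
  · simp only [hfN] at hsum
    exact_mod_cast hsum

/-! ### Behrend's construction for weighted means -/

lemma behrendMap_lt {B : ℕ} : ∀ {k : ℕ} (x : Fin k → ℕ), (∀ i, x i < B) →
    Behrend.map B x < B ^ k := by
  intro k
  induction k with
  | zero => intro x _; simp
  | succ k ih =>
    intro x hx
    rw [Behrend.map_succ']
    have h1 := ih (x ∘ Fin.succ) fun i => hx _
    have h2 := hx 0
    calc x 0 + Behrend.map B (x ∘ Fin.succ) * B < (Behrend.map B (x ∘ Fin.succ) + 1) * B := by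
          rw [add_mul, one_mul]; omega
      _ ≤ B ^ k * B := Nat.mul_le_mul_right _ h1
      _ = B ^ (k + 1) := (pow_succ _ _).symm

/-- Strict convexity of the sphere, through the identity `pq|u - v|² = (p + q)(p|u|² + q|v|²) - |pu
+ qv|²`, whose right side vanishes here. -/
lemma eq_of_convex_combination_on_sphere {k p q R : ℕ} (hp : 0 < p) (hq : 0 < q)
    {u v w : Fin k → ℕ} (hu : ∑ i, u i ^ 2 = R) (hv : ∑ i, v i ^ 2 = R)
    (hw : ∑ i, w i ^ 2 = R) (h : ∀ i, p * u i + q * v i = (p + q) * w i) : u = v := by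
  have h1 : ∀ i, (p * q : ℤ) * ((u i : ℤ) - v i) ^ 2 =
      (p + q) * (p * u i ^ 2 + q * v i ^ 2) - (p + q) ^ 2 * w i ^ 2 := by
    intro i
    have : (p * u i + q * v i : ℤ) = (p + q) * w i := by exact_mod_cast h i
    linear_combination (-(p * u i + q * v i : ℤ) - (p + q) * w i) * this
  have hu' : ∑ i, (u i : ℤ) ^ 2 = R := by exact_mod_cast hu
  have hv' : ∑ i, (v i : ℤ) ^ 2 = R := by exact_mod_cast hv
  have hw' : ∑ i, (w i : ℤ) ^ 2 = R := by exact_mod_cast hw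
  have h2 : ∑ i, (p * q : ℤ) * ((u i : ℤ) - v i) ^ 2 = 0 := by
    rw [Finset.sum_congr rfl fun i _ => h1 i, Finset.sum_sub_distrib, ← Finset.mul_sum,
      ← Finset.mul_sum, Finset.sum_add_distrib, ← Finset.mul_sum, ← Finset.mul_sum, hu', hv', hw']
    ring
  rw [Finset.sum_eq_zero_iff_of_nonneg fun i _ => by positivity] at h2
  funext i
  have h3 := h2 i (Finset.mem_univ _)
  have h4 : (p * q : ℤ) ≠ 0 := by positivity
  have h5 := pow_eq_zero_iff two_ne_zero |>.1 ((mul_eq_zero.1 h3).resolve_left h4)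
  omega

/-- The integers whose digits in a large base form a vector on a sphere. -/
lemma exists_convexFree_of_digits (K Q k : ℕ) (hK : 0 < K) :
    ∃ D : Finset ℕ, (∀ d ∈ D, d < (2 * K * Q) ^ k) ∧ ConvexFree K D ∧
      ((Q ^ k : ℕ) / (k * Q ^ 2 : ℕ) : ℝ) ≤ D.card := by
  obtain ⟨R, hR⟩ := Behrend.exists_large_sphere k Q
  have hlt : ∀ x ∈ Behrend.sphere k Q R, ∀ i, x i < Q := fun x hx =>
    Behrend.mem_box.1 (Behrend.sphere_subset_box hx)
  have hlt' : ∀ x ∈ Behrend.sphere k Q R, ∀ i, x i < 2 * K * Q := fun x hx i =>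
    (hlt x hx i).trans_le (Nat.le_mul_of_pos_left _ (by omega))
  have hmul : ∀ (p : ℕ) (x : Fin k → ℕ), p * Behrend.map (2 * K * Q) x =
      Behrend.map (2 * K * Q) (p • x) := fun p x => by rw [map_nsmul, smul_eq_mul]
  refine ⟨(Behrend.sphere k Q R).image (Behrend.map (2 * K * Q)), ?_, ?_, ?_⟩
  · intro d hd
    obtain ⟨x, hx, rfl⟩ := Finset.mem_image.1 hd
    exact behrendMap_lt x (hlt' x hx)
  · intro p q hp hq hpK hqK a ha b hb c hc h
    obtain ⟨u, hu, rfl⟩ := Finset.mem_image.1 ha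
    obtain ⟨v, hv, rfl⟩ := Finset.mem_image.1 hb
    obtain ⟨w, hw, rfl⟩ := Finset.mem_image.1 hc
    rw [hmul, hmul, hmul, ← map_add] at h
    -- In base `2 * K * Q` the digits of both sides stay below the base, so no carries occur and the
    -- equation holds digit by digit.
    have h1 := Behrend.map_injOn (by
        intro i
        have h1 : p * u i ≤ K * u i := Nat.mul_le_mul_right _ hpK
        have h2 : q * v i ≤ K * v i := Nat.mul_le_mul_right _ hqK
        have h3 : K * u i < K * Q := Nat.mul_lt_mul_of_pos_left (hlt u hu i) hK
        have h4 : K * v i < K * Q := Nat.mul_lt_mul_of_pos_left (hlt v hv i) hK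
        show p * u i + q * v i < 2 * K * Q
        linarith) (by
        intro i
        have h1 : (p + q) * w i ≤ (2 * K) * w i := Nat.mul_le_mul_right _ (by omega)
        have h3 : 2 * K * w i < 2 * K * Q := Nat.mul_lt_mul_of_pos_left (hlt w hw i) (by omega)
        show (p + q) * w i < 2 * K * Q
        omega) h
    rw [eq_of_convex_combination_on_sphere hp hq (Finset.mem_filter.1 hu).2
      (Finset.mem_filter.1 hv).2 (Finset.mem_filter.1 hw).2 fun i => congrFun h1 i]
  · rw [Finset.card_image_of_injOn]
    · exact hR
    · exact Behrend.map_injOn.mono fun x hx i => hlt' x hx i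

lemma eventually_le_sqrt_log (x : ℝ) :
    ∀ᶠ n : ℕ in Filter.atTop, x ≤ Real.sqrt (Real.log n) :=
  (Real.tendsto_sqrt_atTop.comp
    (Real.tendsto_log_atTop.comp tendsto_natCast_atTop_atTop)).eventually_ge_atTop x

/-- Behrend's bound for sets without nontrivial weighted means. -/
lemma exists_convexFree (K : ℕ) (hK : 0 < K) : ∃ β : ℝ, 0 < β ∧
    ∀ᶠ M : ℕ in Filter.atTop, ∃ D : Finset ℕ, (∀ d ∈ D, d < M) ∧ ConvexFree K D ∧
      (M : ℝ) * Real.exp (-β * Real.sqrt (Real.log M)) ≤ D.card := by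
  have hK1 : (1 : ℝ) ≤ K := by exact_mod_cast hK
  have hlogK : 0 < Real.log (4 * K) := Real.log_pos (by linarith)
  -- The first summand pays for `(4K)^k`, lost by rounding the digit bound, and the `4` for the
  -- factor `k * Q ^ 2`, lost in choosing a sphere.
  refine ⟨2 * Real.log (4 * K) + 4, by positivity, ?_⟩
  filter_upwards [eventually_le_sqrt_log 1, eventually_le_sqrt_log (2 * Real.log (4 * K)),
    Filter.eventually_ge_atTop 1] with M hL1 hL2 hM
  set L := Real.sqrt (Real.log M) with hL
  have hMpos : (0 : ℝ) < M := by exact_mod_cast hM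
  have hL0 : 0 < L := by linarith
  have hLM : L ^ 2 = Real.log M := Real.sq_sqrt (Real.log_nonneg (by exact_mod_cast hM))
  -- With about `√(log M)` digits the base is `u = M^(1/k) ≤ e^L`, and `Q` is chosen so that
  -- `(2KQ)^k ≤ M`.
  set k := ⌈L⌉₊ with hk
  have hkL : L ≤ k := Nat.le_ceil L
  have hkL' : (k : ℝ) ≤ 2 * L := by
    have := Nat.ceil_lt_add_one hL0.le
    linarith
  have hk0 : (0 : ℝ) < k := by linarith
  set u := Real.exp (L ^ 2 / k) with hu
  have huk : u ^ k = M := by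
    rw [hu, ← Real.exp_nat_mul, mul_div_cancel₀ _ hk0.ne', hLM, Real.exp_log hMpos]
  have hu4 : 4 * K ≤ u := by
    rw [← Real.exp_log (show (0 : ℝ) < 4 * K by positivity), hu]
    apply Real.exp_le_exp.2
    rw [le_div_iff₀ hk0]
    nlinarith
  have huL : u ≤ Real.exp L := by
    apply Real.exp_le_exp.2
    rw [div_le_iff₀ hk0]
    nlinarith
  set Q := ⌊u / (2 * K)⌋₊ with hQ
  have hQle : (Q : ℝ) ≤ u / (2 * K) := Nat.floor_le (by positivity)
  have hQge : u / (4 * K) ≤ Q := by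
    have h1 := Nat.lt_floor_add_one (u / (2 * K))
    have h2 : 1 ≤ u / (4 * K) := (one_le_div (by positivity)).2 hu4
    have h3 : u / (2 * K) = 2 * (u / (4 * K)) := by field_simp; ring
    linarith
  have hQu : (Q : ℝ) ≤ u :=
    hQle.trans (div_le_self (Real.exp_pos _).le (by linarith))
  have hQpos : (0 : ℝ) < Q := lt_of_lt_of_le (by positivity) hQge
  obtain ⟨D, hD, hconv, hcard⟩ := exists_convexFree_of_digits K Q k hK
  refine ⟨D, fun d hd => (hD d hd).trans_le ?_, hconv, le_trans ?_ hcard⟩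
  · have : ((2 * K * Q : ℕ) : ℝ) ^ k ≤ u ^ k := by
      apply pow_le_pow_left₀ (by positivity)
      push_cast
      rw [le_div_iff₀ (by positivity)] at hQle
      linarith
    rw [huk] at this
    exact_mod_cast this
  · rw [le_div_iff₀ (by push_cast; positivity)]
    push_cast
    have h1 : (M : ℝ) ≤ Real.exp (2 * L * Real.log (4 * K)) * Q ^ k := by
      have h2 : u ≤ 4 * K * Q := by
        rw [div_le_iff₀ (by positivity)] at hQge; linarith
      calc (M : ℝ) = u ^ k := huk.symm
        _ ≤ (4 * K * Q) ^ k := pow_le_pow_left₀ (Real.exp_pos _).le h2 k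
        _ = Real.exp (k * Real.log (4 * K)) * Q ^ k := by
            rw [mul_pow, Real.exp_nat_mul, Real.exp_log (by positivity)]
        _ ≤ _ := by gcongr
    have h2 : (k : ℝ) * Q ^ 2 ≤ Real.exp (4 * L) := by
      calc (k : ℝ) * Q ^ 2 ≤ Real.exp (2 * L) * (Real.exp L) ^ 2 := by
            gcongr
            · linarith [Real.add_one_le_exp (2 * L)]
            · exact hQu.trans huL
        _ = Real.exp (4 * L) := by
            rw [← Real.exp_nat_mul, ← Real.exp_add]; congr 1; push_cast; ring
    calc (M : ℝ) * Real.exp (-(2 * Real.log (4 * K) + 4) * L) * (k * Q ^ 2)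
        ≤ (Real.exp (2 * L * Real.log (4 * K)) * Q ^ k) *
          Real.exp (-(2 * Real.log (4 * K) + 4) * L) * Real.exp (4 * L) := by gcongr
      _ = (Real.exp (2 * L * Real.log (4 * K)) *
          Real.exp (-(2 * Real.log (4 * K) + 4) * L) * Real.exp (4 * L)) * Q ^ k := by ring
      _ = (Q : ℝ) ^ k := by
          rw [← Real.exp_add, ← Real.exp_add]
          ring_nf
          simp

/-! ### Random colouring and deletion -/

open Classical in
-- A tuple of `l + 1` distinct points is monochromatic with probability at most `q^(-l)`:
-- recolouring its last `l` points arbitrarily loses no information, since their old colour survives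
-- at `t 0`.
lemma card_colorings_mul_le {α : Type*} [Fintype α] {l q : ℕ} (t : Fin (l + 1) → α)
    (ht : Function.Injective t) :
    (Finset.univ.filter fun f : α → Fin q => ∀ i, f (t i) = f (t 0)).card * q ^ l ≤
      Fintype.card (α → Fin q) := by
  have h1 : Fintype.card (Fin l → Fin q) = q ^ l := by simp
  rw [← h1, ← Finset.card_univ, ← Finset.card_product, ← Finset.card_univ]
  have ht' : Function.Injective fun i : Fin l => t i.succ :=
    ht.comp (Fin.succ_injective l)
  refine Finset.card_le_card_of_injOn
    (fun p => Function.extend (fun i : Fin l => t i.succ) p.2 p.1)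
    (fun _ _ => Finset.mem_coe.2 (Finset.mem_univ _)) ?_
  rintro ⟨f, g⟩ hf ⟨f', g'⟩ hf' h
  simp only [Finset.coe_product, Set.mem_prod, Finset.mem_coe, Finset.mem_filter,
    Finset.mem_univ, true_and, and_true] at hf hf'
  dsimp only at h
  have hg : g = g' := by
    funext i
    have := congrFun h (t i.succ)
    rwa [ht'.extend_apply, ht'.extend_apply] at this
  have hout : ∀ x, (¬ ∃ i : Fin l, t i.succ = x) → f x = f' x := by
    intro x hx
    have := congrFun h x
    rwa [Function.extend_apply' _ _ _ hx, Function.extend_apply' _ _ _ hx] at this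
  have h0 : f (t 0) = f' (t 0) := hout _ fun ⟨i, hi⟩ => Fin.succ_ne_zero i (ht hi)
  refine Prod.ext (funext fun x => ?_) hg
  by_cases hx : ∃ i : Fin l, t i.succ = x
  · obtain ⟨i, rfl⟩ := hx
    show f _ = f' _
    rw [hf, hf', h0]
  · exact hout x hx

open Classical in
/-- If there are few forbidden tuples, then a random colour class contains so few of them that
they can be destroyed by deletions. -/
lemma exists_avoiding_subset {α : Type*} [Fintype α] {l q : ℕ} (hq : 0 < q)
    (T : Finset (Fin (l + 1) → α)) (hT : ∀ t ∈ T, Function.Injective t)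
    (hcard : 2 * T.card ≤ Fintype.card α * q ^ l) :
    ∃ D : Finset α, Fintype.card α ≤ 2 * q * D.card ∧ ∀ t ∈ T, ¬ ∀ i, t i ∈ D := by
  have : Nonempty (Fin q) := ⟨⟨0, hq⟩⟩
  -- Double counting: some colouring has at most the average number `|T| / q^l ≤ |α| / 2` of
  -- monochromatic tuples.
  have hsum : ∑ f : α → Fin q, (T.filter fun t => ∀ i, f (t i) = f (t 0)).card * q ^ l ≤
      ∑ _f : α → Fin q, T.card := by
    have hdc : ∑ f : α → Fin q, (T.filter fun t => ∀ i, f (t i) = f (t 0)).card =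
        ∑ t ∈ T, (Finset.univ.filter fun f : α → Fin q => ∀ i, f (t i) = f (t 0)).card :=
      Finset.sum_card_bipartiteAbove_eq_sum_card_bipartiteBelow
        fun (f : α → Fin q) (t : Fin (l + 1) → α) => ∀ i, f (t i) = f (t 0)
    rw [← Finset.sum_mul, hdc, Finset.sum_mul,
      Finset.sum_const, Finset.card_univ, smul_eq_mul, mul_comm _ T.card]
    calc _ ≤ ∑ _t ∈ T, Fintype.card (α → Fin q) :=
          Finset.sum_le_sum fun t ht => card_colorings_mul_le t (hT t ht)
      _ = _ := by rw [Finset.sum_const, smul_eq_mul]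
  obtain ⟨f, -, hf⟩ := Finset.exists_le_of_sum_le Finset.univ_nonempty hsum
  set X := (T.filter fun t => ∀ i, f (t i) = f (t 0)).card with hX
  have hX2 : 2 * X ≤ Fintype.card α := by
    have : 2 * X * q ^ l ≤ Fintype.card α * q ^ l := by linarith
    exact Nat.le_of_mul_le_mul_right this (by positivity)
  have hsum1 : ∑ j, (Finset.univ.filter fun x => f x = j).card = Fintype.card α := by
    rw [← Finset.card_univ]
    exact (Finset.card_eq_sum_card_fiberwise fun x _ => Finset.mem_coe.2 (Finset.mem_univ _)).symm
  have hsum2 : ∑ j, (T.filter fun t => ∀ i, f (t i) = j).card = X := by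
    rw [hX, Finset.card_eq_sum_card_fiberwise (f := fun t => f (t 0)) (t := Finset.univ)
      fun x _ => Finset.mem_coe.2 (Finset.mem_univ _)]
    refine Finset.sum_congr rfl fun j _ => ?_
    rw [Finset.filter_filter]
    congr 1
    refine Finset.filter_congr fun t _ => ?_
    exact ⟨fun h => ⟨fun i => by rw [h, h], h 0⟩, fun h i => by rw [h.1, h.2]⟩
  -- Summed over the colours this reads `q|α| + 2qX ≤ 2q|α|`, so some colour class is large even
  -- after one deletion per tuple.
  have hsum3 : ∑ j : Fin q,
      (Fintype.card α + 2 * q * (T.filter fun t => ∀ i, f (t i) = j).card) ≤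
      ∑ j : Fin q, 2 * q * (Finset.univ.filter fun x => f x = j).card := by
    rw [Finset.sum_add_distrib, ← Finset.mul_sum, ← Finset.mul_sum, hsum1, hsum2,
      Finset.sum_const, Finset.card_univ, Fintype.card_fin, smul_eq_mul]
    nlinarith
  obtain ⟨j, -, hj⟩ := Finset.exists_le_of_sum_le Finset.univ_nonempty hsum3
  refine ⟨(Finset.univ.filter fun x => f x = j) \
    (T.filter fun t => ∀ i, f (t i) = j).image fun t => t 0, ?_, ?_⟩
  · have h1 := Finset.le_card_sdiff ((T.filter fun t => ∀ i, f (t i) = j).image fun t => t 0)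
      (Finset.univ.filter fun x => f x = j)
    have h2 := Finset.card_image_le (s := T.filter fun t => ∀ i, f (t i) = j)
      (f := fun t => t 0)
    have h3 : (Finset.univ.filter fun x => f x = j).card ≤
        ((Finset.univ.filter fun x => f x = j) \
          (T.filter fun t => ∀ i, f (t i) = j).image fun t => t 0).card +
        (T.filter fun t => ∀ i, f (t i) = j).card := by omega
    have h4 := Nat.mul_le_mul_left (2 * q) h3
    rw [mul_add] at h4
    omega
  · intro t ht hall
    simp only [Finset.mem_sdiff, Finset.mem_filter, Finset.mem_univ, true_and] at hall
    exact (hall 0).2 (Finset.mem_image_of_mem _ (Finset.mem_filter.2 ⟨ht, fun i => (hall i).1⟩))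

/-- The reflected pairs of triples in a set without weighted means consist of six elements. -/
lemma ConvexFree.injective_of_reflection {S : Finset ℕ} (hS : ConvexFree 2 S)
    {a b : Fin 3 → ℕ} (ha : ∀ i, a i ∈ S) (hb : ∀ i, b i ∈ S) (hne : ∀ i j, a i ≠ b j)
    (hab : ∀ i, a i + b i = a 0 + b 0) (hsum : ∑ i, a i = ∑ i, b i) :
    Function.Injective (Fin.append a b) := by
  rw [Fin.sum_univ_three, Fin.sum_univ_three] at hsum
  have h1 := hab 1
  have h2 := hab 2
  -- A coincidence produces a mean with weights `1` and `2`; for example `a 0 = a 1` gives `a 0 + 2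
  -- * a 2 = 3 * b 0`.
  have key : ∀ x ∈ S, ∀ y ∈ S, ∀ z ∈ S, x + 2 * y = 3 * z → x = y := fun x hx y hy z hz h =>
    hS 1 2 (by omega) (by omega) (by omega) (by omega) x hx y hy z hz (by omega)
  have n01 : a 0 ≠ a 1 := fun h => by
    have := key _ (ha 0) _ (ha 2) _ (hb 0) (by omega)
    exact hne 0 0 (by omega)
  have n02 : a 0 ≠ a 2 := fun h => by
    have := key _ (ha 0) _ (ha 1) _ (hb 0) (by omega)
    exact hne 0 0 (by omega)
  have n12 : a 1 ≠ a 2 := fun h => by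
    have := key _ (ha 1) _ (ha 0) _ (hb 1) (by omega)
    exact hne 1 1 (by omega)
  rw [Fin.append_injective_iff]
  refine ⟨?_, ?_, hne⟩
  · intro i j h
    fin_cases i <;> fin_cases j <;> simp at h ⊢ <;> omega
  · intro i j h
    fin_cases i <;> fin_cases j <;> simp at h ⊢ <;> omega

/-- The sum condition determines the common value of `a i + b i` from the triple `a`, and so
determines `b`; hence there are at most `|S|^3` bad sextuples. Their six entries are distinct, so
the deletion argument applies with `l = 5`. -/
lemma exists_reflectionFree {S : Finset ℕ} (hS : ConvexFree 2 S) {q : ℕ} (hq : 0 < q)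
    (hSq : 2 * S.card ^ 2 ≤ q ^ 5) :
    ∃ D ⊆ S, S.card ≤ 2 * q * D.card ∧ ReflectionFree D := by
  classical
  let T : Finset (Fin 6 → S) := Finset.univ.filter fun t => Function.Injective t ∧
    ((t 0 : ℕ) + t 3 = t 1 + t 4 ∧ (t 0 : ℕ) + t 3 = t 2 + t 5) ∧
    (t 0 : ℕ) + t 1 + t 2 = t 3 + t 4 + t 5
  have hT : T.card ≤ S.card ^ 3 := by
    have h1 : Fintype.card (Fin 3 → S) = S.card ^ 3 := by simp
    rw [← h1, ← Finset.card_univ]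
    refine Finset.card_le_card_of_injOn (fun t => ![t 0, t 1, t 2])
      (fun _ _ => Finset.mem_coe.2 (Finset.mem_univ _)) ?_
    intro t ht t' ht' h
    simp only [T, Finset.coe_filter, Finset.mem_univ, true_and, Set.mem_ofPred_eq] at ht ht'
    have e0 : t 0 = t' 0 := congrFun h 0
    have e1 : t 1 = t' 1 := congrFun h 1
    have e2 : t 2 = t' 2 := congrFun h 2
    have f0 : (t 0 : ℕ) = t' 0 := by rw [e0]
    have f1 : (t 1 : ℕ) = t' 1 := by rw [e1]
    have f2 : (t 2 : ℕ) = t' 2 := by rw [e2]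
    obtain ⟨-, ⟨h1, h2⟩, h3⟩ := ht
    obtain ⟨-, ⟨h1', h2'⟩, h3'⟩ := ht'
    have g3 : (t 3 : ℕ) = t' 3 := by omega
    have g4 : (t 4 : ℕ) = t' 4 := by omega
    have g5 : (t 5 : ℕ) = t' 5 := by omega
    funext i
    fin_cases i
    exacts [e0, e1, e2, Subtype.ext g3, Subtype.ext g4, Subtype.ext g5]
  obtain ⟨D, hD, hDT⟩ := exists_avoiding_subset (l := 5) hq T
    (fun t ht => (Finset.mem_filter.1 ht).2.1) (by
      rw [Fintype.card_coe]
      calc 2 * T.card ≤ 2 * S.card ^ 3 := by omega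
        _ = S.card * (2 * S.card ^ 2) := by ring
        _ ≤ S.card * q ^ 5 := Nat.mul_le_mul_left _ hSq)
  refine ⟨D.map (Function.Embedding.subtype _), ?_, ?_, ?_⟩
  · intro x hx
    obtain ⟨y, -, rfl⟩ := Finset.mem_map.1 hx
    exact y.2
  · rwa [Finset.card_map, ← Fintype.card_coe]
  · intro a b ha hb hne hab hsum
    have hsub : ∀ x ∈ D.map (Function.Embedding.subtype _), ∃ h : x ∈ S, (⟨x, h⟩ : S) ∈ D := by
      intro x hx
      obtain ⟨y, hy, rfl⟩ := Finset.mem_map.1 hx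
      exact ⟨y.2, hy⟩
    choose haS haD using fun i => hsub _ (ha i)
    choose hbS hbD using fun i => hsub _ (hb i)
    have hinj := hS.injective_of_reflection haS hbS hne hab hsum
    rw [Fin.sum_univ_three, Fin.sum_univ_three] at hsum
    have h1 := hab 1
    have h2 := hab 2
    let t : Fin 6 → S := Fin.append (m := 3) (n := 3) (fun i => ⟨a i, haS i⟩)
      (fun i => ⟨b i, hbS i⟩)
    have ht : ∀ i, (t i : ℕ) = Fin.append a b i := by
      intro i
      fin_cases i <;> rfl
    refine hDT t (Finset.mem_filter.2 ⟨Finset.mem_univ _, ?_, ?_, ?_⟩) ?_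
    · intro i j h
      apply hinj
      rw [← ht, ← ht, h]
    · exact ⟨h1.symm, h2.symm⟩
    · exact hsum
    · intro i
      fin_cases i
      exacts [haD 0, haD 1, haD 2, hbD 0, hbD 1, hbD 2]

lemma ConvexFree.mono {K K' : ℕ} {D D' : Finset ℕ} (h : ConvexFree K D) (hK : K' ≤ K)
    (hD : D' ⊆ D) : ConvexFree K' D' := fun p q hp hq hpK hqK a ha b hb c hc =>
  h p q hp hq (hpK.trans hK) (hqK.trans hK) a (hD ha) b (hD hb) c (hD hc)

lemma exists_convexFree_reflectionFree : ∃ β : ℝ, 0 < β ∧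
    ∀ᶠ M : ℕ in Filter.atTop, ∃ D : Finset ℕ, (∀ d ∈ D, d < M) ∧ ConvexFree 3 D ∧
      ReflectionFree D ∧
      (M : ℝ) ^ (0.6 : ℝ) * Real.exp (-β * Real.sqrt (Real.log M)) ≤ D.card := by
  obtain ⟨β, hβ, h⟩ := exists_convexFree 3 (by omega)
  -- The term `0.6 * β` comes from Behrend's bound raised to the power `0.6`; the `3` absorbs the
  -- constant `8 ≤ e^(3L)`.
  refine ⟨0.6 * β + 3, by positivity, ?_⟩
  filter_upwards [h, eventually_le_sqrt_log 1, Filter.eventually_ge_atTop 1]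
    with M ⟨S, hSM, hS, hcard⟩ hL hM
  set L := Real.sqrt (Real.log M)
  have hMpos : (0 : ℝ) < M := by exact_mod_cast hM
  have hs0 : (0 : ℝ) < S.card := lt_of_lt_of_le (by positivity) hcard
  have hs1 : (1 : ℝ) ≤ S.card := by exact_mod_cast (by exact_mod_cast hs0 : 0 < S.card)
  -- The least admissible number of colours is about `|S|^(2/5)`, which leaves about `|S|^(3/5)`
  -- elements.
  set y : ℝ := (2 * (S.card : ℝ) ^ 2) ^ (0.2 : ℝ) with hy
  have hy1 : 1 ≤ y := Real.one_le_rpow (by nlinarith) (by norm_num)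
  have hy5 : y ^ 5 = 2 * (S.card : ℝ) ^ 2 := by
    rw [hy, ← Real.rpow_natCast, ← Real.rpow_mul (by positivity)]
    norm_num
  have hyle : y ≤ 2 * (S.card : ℝ) ^ (0.4 : ℝ) := by
    rw [hy, Real.mul_rpow (by norm_num) (by positivity), ← Real.rpow_natCast _ 2,
      ← Real.rpow_mul hs0.le]
    have h2 : (2 : ℝ) ^ (0.2 : ℝ) ≤ 2 := by
      calc (2 : ℝ) ^ (0.2 : ℝ) ≤ 2 ^ (1 : ℝ) :=
            Real.rpow_le_rpow_of_exponent_le (by norm_num) (by norm_num)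
        _ = 2 := Real.rpow_one 2
    have h3 : ((2 : ℕ) : ℝ) * 0.2 = 0.4 := by norm_num
    rw [h3]
    gcongr
  have hq5 : 2 * S.card ^ 2 ≤ ⌈y⌉₊ ^ 5 := by
    have h2 : (2 * (S.card : ℝ) ^ 2) ≤ (⌈y⌉₊ : ℝ) ^ 5 := by
      rw [← hy5]
      exact pow_le_pow_left₀ (by linarith) (Nat.le_ceil y) 5
    exact_mod_cast h2
  obtain ⟨D, hDS, hD, hrefl⟩ := exists_reflectionFree (hS.mono (by omega) subset_rfl)
    (Nat.ceil_pos.2 (by linarith)) hq5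
  refine ⟨D, fun d hd => hSM d (hDS hd), hS.mono le_rfl hDS, hrefl, ?_⟩
  have h1 : (S.card : ℝ) ≤ 2 * ⌈y⌉₊ * D.card := by exact_mod_cast hD
  have h2 : (⌈y⌉₊ : ℝ) ≤ 4 * (S.card : ℝ) ^ (0.4 : ℝ) := by
    have := Nat.ceil_lt_add_one (show 0 ≤ y by linarith)
    linarith
  have h4 : (S.card : ℝ) ^ (0.6 : ℝ) ≤ 8 * D.card := by
    have h5 : (0 : ℝ) < (S.card : ℝ) ^ (0.4 : ℝ) := Real.rpow_pos_of_pos hs0 _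
    refine le_of_mul_le_mul_left ?_ h5
    rw [← Real.rpow_add hs0, show (0.4 + 0.6 : ℝ) = 1 by norm_num, Real.rpow_one]
    calc (S.card : ℝ) ≤ 2 * ⌈y⌉₊ * D.card := h1
      _ ≤ 2 * (4 * (S.card : ℝ) ^ (0.4 : ℝ)) * D.card := by gcongr
      _ = _ := by ring
  have h5 : (M : ℝ) ^ (0.6 : ℝ) * Real.exp (-(0.6 * β) * L) ≤ 8 * D.card := by
    refine le_trans (le_of_eq ?_) ((Real.rpow_le_rpow (by positivity) hcard
      (show (0 : ℝ) ≤ 0.6 by norm_num)).trans h4)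
    rw [Real.mul_rpow hMpos.le (Real.exp_pos _).le, ← Real.exp_mul]
    congr 2; ring
  have h6 : 8 * Real.exp (-(3 * L)) ≤ 1 := by
    have e1 : (2 : ℝ) ≤ Real.exp L := by linarith [Real.add_one_le_exp L]
    have e2 : Real.exp (3 * L) = Real.exp L ^ 3 := by
      rw [← Real.exp_nat_mul]; norm_num
    have e3 : (2 : ℝ) ^ 3 ≤ Real.exp L ^ 3 := pow_le_pow_left₀ (by norm_num) e1 3
    rw [Real.exp_neg, ← div_eq_mul_inv, div_le_one (Real.exp_pos _), e2]
    linarith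
  have h7 : Real.exp (-(0.6 * β + 3) * L) = Real.exp (-(0.6 * β) * L) * Real.exp (-(3 * L)) := by
    rw [← Real.exp_add]; congr 1; ring
  rw [h7, ← mul_assoc]
  calc (M : ℝ) ^ (0.6 : ℝ) * Real.exp (-(0.6 * β) * L) * Real.exp (-(3 * L))
      ≤ 8 * D.card * Real.exp (-(3 * L)) := by gcongr
    _ = D.card * (8 * Real.exp (-(3 * L))) := by ring
    _ ≤ D.card * 1 := by gcongr
    _ = D.card := mul_one _

/-! ### From directions to the Turán number -/

/-- A dense supply of sets of directions yields dense hypergraphs. -/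
lemma exists_hypergraph_of_directions {r : ℕ} (hr : 2 ≤ r) {ρ β : ℝ} (hρ : 0 ≤ ρ) (hβ : 0 < β)
    (h : ∀ᶠ M : ℕ in Filter.atTop, ∃ D : Finset ℕ, (∀ d ∈ D, d < M) ∧ ConvexFree r D ∧
      (∀ (n m : ℕ) [NeZero m] (φ : Fin r × ZMod m ↪ Fin n), 8 * r * M ≤ m →
        Avoids (lineHypergraph φ D) (grids (Fin n) r r)) ∧
      (M : ℝ) ^ ρ * Real.exp (-β * Real.sqrt (Real.log M)) ≤ D.card) :
    ∃ γ : ℝ, 0 < γ ∧ ∀ᶠ n : ℕ in Filter.atTop, ∃ F : Finset (Finset (Fin n)),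
      (F : Set (Finset (Fin n))).Sized r ∧ IsLinear F ∧
      Avoids F (triangles (Fin n)) ∧ Avoids F (grids (Fin n) r r) ∧
      (n : ℝ) ^ (1 + ρ) * Real.exp (-γ * Real.sqrt (Real.log n)) ≤ (F.card : ℝ) ∧
      (r ∣ n → DecomposesIntoPerfectMatchings F ∧ IsRegular F) := by
  have hr0 : (2 : ℝ) ≤ r := by exact_mod_cast hr
  -- Since `M = ⌊n / (8r²)⌋ ≥ 1`, rounding costs at most a factor two and `n / C ≤ M`. The lost
  -- factor `C^(1 + ρ)` is absorbed by the exponential once `√(log n) ≥ 1`.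
  set C : ℝ := 16 * r ^ 2 with hC
  have hC1 : 1 < C := by nlinarith
  refine ⟨β + (1 + ρ) * Real.log C, by have := Real.log_pos hC1; positivity, ?_⟩
  have hdiv : Filter.Tendsto (fun n : ℕ => n / (r * (8 * r))) Filter.atTop Filter.atTop :=
    Nat.tendsto_div_const_atTop (by positivity)
  filter_upwards [hdiv.eventually h, eventually_le_sqrt_log 1,
    Filter.eventually_ge_atTop (r * (8 * r))] with n ⟨D, hDM, hconv, hgrid, hcard⟩ hL hn
  set M := n / (r * (8 * r)) with hMdef
  have hMm : M = n / r / (8 * r) := (Nat.div_div_eq_div_mul _ _ _).symm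
  set m := n / r with hm
  have hM1 : 1 ≤ M := (Nat.one_le_div_iff (by positivity)).2 hn
  have hbound : 8 * r * M ≤ m := by rw [hMm]; exact Nat.mul_div_le _ _
  have hm1 : 1 ≤ m := by nlinarith
  have : NeZero m := ⟨by omega⟩
  have hrm : r * m ≤ n := Nat.mul_div_le _ _
  have hcardV : Fintype.card (Fin r × ZMod m) = r * m := by simp [ZMod.card]
  obtain ⟨φ⟩ : Nonempty (Fin r × ZMod m ↪ Fin n) :=
    Function.Embedding.nonempty_of_card_le (by rw [hcardV, Fintype.card_fin]; exact hrm)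
  refine ⟨lineHypergraph φ D, sized_lineHypergraph, isLinear_lineHypergraph hbound hDM,
    avoids_triangles hbound hDM hconv, hgrid n m φ hbound, ?_, ?_⟩
  · rw [card_lineHypergraph hr hbound hDM]
    have hnpos : (0 : ℝ) < n := by
      have : 0 < r * (8 * r) := by positivity
      exact_mod_cast (by omega : 0 < n)
    have hn8 : n ≤ M * (r * (8 * r)) + r * (8 * r) := by
      have := Nat.lt_div_mul_add (a := n) (show 0 < r * (8 * r) by positivity)
      exact this.le
    have hMC : (n : ℝ) / C ≤ M := by
      rw [div_le_iff₀ (by positivity), hC]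
      have h1 : (n : ℝ) ≤ M * (r * (8 * r)) + r * (8 * r) := by exact_mod_cast hn8
      have h2 : (1 : ℝ) ≤ M := by exact_mod_cast hM1
      nlinarith [mul_nonneg (sub_nonneg.2 h2) (show (0 : ℝ) ≤ r * (8 * r) by positivity)]
    have hMm' : (M : ℝ) ≤ m := by
      exact_mod_cast le_trans (Nat.le_mul_of_pos_left M (by positivity)) hbound
    have hMn : (M : ℝ) ≤ n := by exact_mod_cast Nat.div_le_self _ _
    have hMpos : (0 : ℝ) < M := by exact_mod_cast hM1
    set L := Real.sqrt (Real.log n)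
    have hlog : Real.sqrt (Real.log M) ≤ L :=
      Real.sqrt_le_sqrt (Real.log_le_log hMpos hMn)
    have h1 : (n / C : ℝ) ^ (1 + ρ) * Real.exp (-β * L) ≤ m * D.card := by
      calc (n / C : ℝ) ^ (1 + ρ) * Real.exp (-β * L)
          = (n / C) * ((n / C : ℝ) ^ ρ * Real.exp (-β * L)) := by
            rw [Real.rpow_add (by positivity), Real.rpow_one, mul_assoc]
        _ ≤ m * ((M : ℝ) ^ ρ * Real.exp (-β * Real.sqrt (Real.log M))) := by
            apply mul_le_mul (hMC.trans hMm') _ (by positivity) (by positivity)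
            apply mul_le_mul (Real.rpow_le_rpow (by positivity) hMC hρ) _ (by positivity)
              (by positivity)
            apply Real.exp_le_exp.2
            nlinarith
        _ ≤ m * D.card := by gcongr
    push_cast
    refine le_trans ?_ h1
    rw [Real.div_rpow hnpos.le (by positivity), div_mul_eq_mul_div, le_div_iff₀ (by positivity),
      mul_assoc]
    gcongr
    rw [Real.rpow_def_of_pos (by positivity), ← Real.exp_add]
    apply Real.exp_le_exp.2
    have h2 : 0 ≤ (1 + ρ) * Real.log C := by have := Real.log_pos hC1; positivity
    nlinarith
  · intro hdvd
    -- If `r` divides `n`, then `r * m = n` and no vertex is left outside the classes.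
    have hsurj : Function.Surjective φ := by
      have hc : Fintype.card (Fin r × ZMod m) = Fintype.card (Fin n) := by
        rw [hcardV, Fintype.card_fin]; exact Nat.mul_div_cancel' hdvd
      exact ((Fintype.bijective_iff_injective_and_card φ).2 ⟨φ.injective, hc⟩).2
    have := decomposes_lineHypergraph hr hbound hDM hsurj
    exact ⟨this, this.isRegular⟩

lemma card_le_turanNumber {r n : ℕ} {F : Finset (Finset (Fin n))}
    (hF : (F : Set (Finset (Fin n))).Sized r) (hlin : IsLinear F)
    (htri : Avoids F (triangles (Fin n))) (hgrid : Avoids F (grids (Fin n) r r)) :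
    F.card ≤ turanNumber r n
      (bigIntersections (Fin n) ∪ triangles (Fin n) ∪ grids (Fin n) r r) := by
  classical
  rw [turanNumber]
  refine Finset.le_sup (f := Finset.card)
    (Finset.mem_filter.2 ⟨Finset.mem_univ _, hF, ?_⟩)
  rintro C hC ((hbig | h) | h)
  · obtain ⟨A, B, hne, hcard, rfl⟩ := hbig
    have := hlin A (hC (by simp)) B (hC (by simp)) hne
    omega
  · exact htri C hC h
  · exact hgrid C hC h

lemma turanNumber_lower_bound {r : ℕ} {τ γ : ℝ} (hγ : 0 < γ)
    (h : ∀ᶠ n : ℕ in Filter.atTop, ∃ F : Finset (Finset (Fin n)),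
      (F : Set (Finset (Fin n))).Sized r ∧ IsLinear F ∧
      Avoids F (triangles (Fin n)) ∧ Avoids F (grids (Fin n) r r) ∧
      (n : ℝ) ^ τ * Real.exp (-γ * Real.sqrt (Real.log n)) ≤ (F.card : ℝ) ∧
      (r ∣ n → DecomposesIntoPerfectMatchings F ∧ IsRegular F)) :
    ∃ (n₀ : ℕ) (β : ℝ), 0 < β ∧ ∀ n : ℕ, n₀ ≤ n →
      (n : ℝ) ^ τ * Real.exp (-β * Real.sqrt (Real.log n)) <
        (turanNumber r n
          (bigIntersections (Fin n) ∪ triangles (Fin n) ∪ grids (Fin n) r r) : ℝ) ∧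
      ∃ F : Finset (Finset (Fin n)),
        (F : Set (Finset (Fin n))).Sized r ∧ IsLinear F ∧
        Avoids F (triangles (Fin n)) ∧ Avoids F (grids (Fin n) r r) ∧
        (n : ℝ) ^ τ * Real.exp (-β * Real.sqrt (Real.log n)) ≤ (F.card : ℝ) ∧
        (r ∣ n → DecomposesIntoPerfectMatchings F ∧ IsRegular F) := by
  obtain ⟨n₀, hn₀⟩ := Filter.eventually_atTop.1
    (h.and ((eventually_le_sqrt_log 1).and (Filter.eventually_ge_atTop 1)))
  -- Enlarging the constant by one makes the inequality strict, because `√(log n) ≥ 1`.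
  refine ⟨n₀, γ + 1, by positivity, fun n hn => ?_⟩
  obtain ⟨⟨F, h1, h2, h3, h4, h5, h6⟩, hL, hn1⟩ := hn₀ n hn
  have hlt : (n : ℝ) ^ τ * Real.exp (-(γ + 1) * Real.sqrt (Real.log n)) < F.card := by
    refine lt_of_lt_of_le ?_ h5
    have hn0 : (0 : ℝ) < n := by exact_mod_cast hn1
    apply mul_lt_mul_of_pos_left _ (by positivity)
    apply Real.exp_lt_exp.2
    linarith
  refine ⟨hlt.trans_le ?_, F, h1, h2, h3, h4, hlt.le, h6⟩
  exact_mod_cast card_le_turanNumber h1 h2 h3 h4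

end HypergraphTuran

open HypergraphTuran in
theorem theorem2 :
    (∀ r : ℕ, 4 ≤ r → ∃ (n₀ : ℕ) (β : ℝ), 0 < β ∧ ∀ n : ℕ, n₀ ≤ n →
      (n : ℝ) ^ 2 * Real.exp (-β * Real.sqrt (Real.log n)) <
        (turanNumber r n
          (bigIntersections (Fin n) ∪ triangles (Fin n) ∪ grids (Fin n) r r) : ℝ) ∧
      ∃ F : Finset (Finset (Fin n)),
        (F : Set (Finset (Fin n))).Sized r ∧ IsLinear F ∧
        Avoids F (triangles (Fin n)) ∧ Avoids F (grids (Fin n) r r) ∧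
        (n : ℝ) ^ 2 * Real.exp (-β * Real.sqrt (Real.log n)) ≤ (F.card : ℝ) ∧
        (r ∣ n → DecomposesIntoPerfectMatchings F ∧ IsRegular F)) ∧
    (∃ (n₀ : ℕ) (β : ℝ), 0 < β ∧ ∀ n : ℕ, n₀ ≤ n →
      (n : ℝ) ^ (1.6 : ℝ) * Real.exp (-β * Real.sqrt (Real.log n)) <
        (turanNumber 3 n
          (bigIntersections (Fin n) ∪ triangles (Fin n) ∪ grids (Fin n) 3 3) : ℝ) ∧
      ∃ F : Finset (Finset (Fin n)),
        (F : Set (Finset (Fin n))).Sized 3 ∧ IsLinear F ∧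
        Avoids F (triangles (Fin n)) ∧ Avoids F (grids (Fin n) 3 3) ∧
        (n : ℝ) ^ (1.6 : ℝ) * Real.exp (-β * Real.sqrt (Real.log n)) ≤ (F.card : ℝ) ∧
        (3 ∣ n → DecomposesIntoPerfectMatchings F ∧ IsRegular F)) := by
  constructor
  · intro r hr
    obtain ⟨β, hβ, h⟩ := exists_convexFree r (by omega)
    obtain ⟨γ, hγ, h'⟩ := exists_hypergraph_of_directions (r := r) (ρ := 1) (by omega)
      zero_le_one hβ (h.mono fun M ⟨D, hD, hconv, hcard⟩ =>
        ⟨D, hD, hconv, fun n m _ φ hM => avoids_grids_of_four_le hr hM hD, by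
          rwa [Real.rpow_one]⟩)
    rw [one_add_one_eq_two] at h'
    simpa only [Real.rpow_two] using turanNumber_lower_bound hγ h'
  · obtain ⟨β, hβ, h⟩ := exists_convexFree_reflectionFree
    obtain ⟨γ, hγ, h'⟩ := exists_hypergraph_of_directions (r := 3) (ρ := 0.6) (by omega)
      (by norm_num) hβ (h.mono fun M ⟨D, hD, hconv, hrefl, hcard⟩ =>
        ⟨D, hD, hconv, fun n m _ φ hM => avoids_grids_of_reflectionFree hM hD hrefl, hcard⟩)
    rw [show (1 + 0.6 : ℝ) = 1.6 by norm_num] at h'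
    exact turanNumber_lower_bound hγ h'
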